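/- For a finite set $\mathcal D$ and probability distributions $P,Q$ on $\mathcal D$ let $D_H^2(P,Q)=\frac12\sum_{x\in\mathcal D}\bigl(\sqrt{P(x)}-\sqrt{Q(x)}\bigr)^2$ be the squared Hellinger distance. Let $A,C$ be finite alphabets of sizes $d_A\ge d_C\ge 1$ and let $\varepsilon>0$. A (possibly randomized) tester receives $N$ i.i.d. samples from each of two unknown distributions $P_{AC}$ and $Q_{AC}$ on $A\times C$ (all samples independent), where $Q_{AC}=Q_AQ_C$ is promised to be a product distribution, and outputs "Yes" or "No". It succeeds if, for all such $P_{AC}$ and $Q_{AC}$, it outputs "Yes" with probability at least $2/3$ whenever $P_{AC}=Q_AQ_C$, and outputs "No" with probability at least $2/3$ whenever $D_H^2(P_{AC},Q_AQ_C)\ge\varepsilon$. Let $\mathrm{SC}_{\mathrm{EqProd}}(D_H^2,\varepsilon,d_A,d_C)$ be the least $N$ for which a successful tester exists ($\infty$ if there is none). Then $$\mathrm{SC}_{\mathrm{EqProd}}(D_H^2,\varepsilon,d_A,d_C)=\widetilde O\left(\min\left\{\frac{d_A^{3/4}d_C^{1/4}}{\varepsilon},\ \frac{d_A^{2/3}d_C^{1/3}}{\varepsilon^{4/3}}\right\}\right),$$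 that is, there are universal constants $K>0$ and $k\in\mathbb N$ such that for all integers $d_A\ge d_C\ge1$ and all $\varepsilon>0$ $$\mathrm{SC}_{\mathrm{EqProd}}(D_H^2,\varepsilon,d_A,d_C)\le K\,\log^k\!\left(2+\frac{d_Ad_C}{\varepsilon}\right)\min\left\{\frac{d_A^{3/4}d_C^{1/4}}{\varepsilon},\ \frac{d_A^{2/3}d_C^{1/3}}{\varepsilon^{4/3}}\right\}.$$ -/

import Mathlib

open MeasureTheory
open scoped ENNReal

noncomputable section

namespace EqProd

/-- The squared Hellinger distance `½ ∑ₓ (√P(x) - √Q(x))²` of two distributions on a finite set. -/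
def hellingerSq {Ω : Type} [Fintype Ω] (P Q : PMF Ω) : ℝ :=
  (1 / 2) * ∑ x, (Real.sqrt (P x).toReal - Real.sqrt (Q x).toReal) ^ 2

/-- `Q` is a product distribution `Q_A Q_C` on `A × C`. -/
def IsProduct {A C : Type} (Q : PMF (A × C)) : Prop :=
  ∃ (QA : PMF A) (QC : PMF C), ∀ a c, Q (a, c) = QA a * QC c

/-- The joint law of `N` independent samples from `P`. -/
def iidLaw {Ω : Type} [MeasurableSpace Ω] (P : PMF Ω) (N : ℕ) : Measure (Fin N → Ω) :=
  Measure.pi fun _ => P.toMeasure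

/-- A (possibly randomized) tester that reads `N` samples from each of two distributions on `Ω`
and outputs `true` ("Yes", equal) or `false` ("No", far). The value is the law of its output
given the samples. -/
abbrev Tester (Ω : Type) (N : ℕ) : Type := (Fin N → Ω) → (Fin N → Ω) → PMF Bool

/-- The probability that the tester `T` outputs `b` when it is given `N` i.i.d. samples from `P`
and, independently, `N` i.i.d. samples from `Q`. -/
def outputProb {Ω : Type} [MeasurableSpace Ω] {N : ℕ} (T : Tester Ω N) (P Q : PMF Ω) (b : Bool) :
    ℝ≥0∞ :=
  ∫⁻ s, T s.1 s.2 b ∂((iidLaw P N).prod (iidLaw Q N))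

/-- `T` solves equivalence testing for product distributions at threshold `ε` with respect to
the distance measure `Δ`, with success probability at least `2/3`. -/
def Succeeds {A C : Type} [MeasurableSpace A] [MeasurableSpace C]
    (Δ : PMF (A × C) → PMF (A × C) → ℝ) (ε : ℝ) {N : ℕ} (T : Tester (A × C) N) : Prop :=
  ∀ P Q : PMF (A × C), IsProduct Q →
    (P = Q → 2 / 3 ≤ outputProb T P Q true) ∧
    (ε ≤ Δ P Q → 2 / 3 ≤ outputProb T P Q false)

/-- The sample complexity of equivalence testing for product distributions on `A × C`: the least
number `N` of samples (from each distribution) for which a successful tester exists;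
it is `⊤` if there is no such `N`. -/
def sampleComplexity {A C : Type} [MeasurableSpace A] [MeasurableSpace C]
    (Δ : PMF (A × C) → PMF (A × C) → ℝ) (ε : ℝ) : ℕ∞ :=
  ⨅ (N : ℕ) (_ : ∃ T : Tester (A × C) N, Succeeds Δ ε T), (N : ℕ∞)

end EqProd

end

open MeasureTheory
open scoped ENNReal

noncomputable section

namespace EqProd

section Expectation

variable {X : Type} [Fintype X]

/-- The expectation of `f` under `n` independent draws from the finite weight function `R`. -/
def piExp (R : X → ℝ) (n : ℕ) (f : (Fin n → X) → ℝ) : ℝ :=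
  ∑ s, (∏ i, R (s i)) * f s

theorem piExp_mono {R : X → ℝ} (hR : ∀ x, 0 ≤ R x) {n : ℕ} {f g : (Fin n → X) → ℝ}
    (h : ∀ s, f s ≤ g s) : piExp R n f ≤ piExp R n g :=
  Finset.sum_le_sum fun s _ =>
    mul_le_mul_of_nonneg_left (h s) (Finset.prod_nonneg fun _ _ => hR _)

theorem piExp_add (R : X → ℝ) {n : ℕ} (f g : (Fin n → X) → ℝ) :
    piExp R n (fun s => f s + g s) = piExp R n f + piExp R n g := by
  simp only [piExp, mul_add, Finset.sum_add_distrib]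

theorem piExp_const_mul (R : X → ℝ) {n : ℕ} (c : ℝ) (f : (Fin n → X) → ℝ) :
    piExp R n (fun s => c * f s) = c * piExp R n f := by
  simp only [piExp, Finset.mul_sum]
  exact Finset.sum_congr rfl fun s _ => by ring

theorem piExp_sum (R : X → ℝ) {n : ℕ} {κ : Type} (t : Finset κ) (f : κ → (Fin n → X) → ℝ) :
    piExp R n (fun s => ∑ j ∈ t, f j s) = ∑ j ∈ t, piExp R n (f j) := by
  simp only [piExp, Finset.mul_sum]
  exact Finset.sum_comm

theorem piExp_prod (R : X → ℝ) {n : ℕ} (f : Fin n → X → ℝ) :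
    piExp R n (fun s => ∏ i, f i (s i)) = ∏ i, ∑ x, R x * f i x := by
  classical
  simp only [piExp, ← Finset.prod_mul_distrib]
  rw [Finset.prod_univ_sum, Fintype.piFinset_univ]

theorem piExp_const {R : X → ℝ} (hR : ∑ x, R x = 1) (n : ℕ) (c : ℝ) :
    piExp R n (fun _ => c) = c := by
  have h := piExp_prod R (n := n) (fun _ _ => 1)
  have h2 := piExp_const_mul R (n := n) c (fun _ => 1)
  simp only [Finset.prod_const_one, mul_one, hR] at h h2
  rw [h2, h, mul_one]

theorem piExp_succ (R : X → ℝ) {n : ℕ} (f : (Fin (n + 1) → X) → ℝ) :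
    piExp R (n + 1) f = ∑ x, R x * piExp R n (fun s => f (Fin.cons x s)) := by
  unfold piExp
  rw [← (Fin.consEquiv (fun _ => X)).sum_comp, Fintype.sum_prod_type]
  refine Finset.sum_congr rfl fun x _ => ?_
  rw [Finset.mul_sum]
  refine Finset.sum_congr rfl fun s _ => ?_
  simp [Fin.consEquiv, Fin.prod_univ_succ, mul_assoc]

theorem piExp_sum_apply {R : X → ℝ} (hR : ∑ x, R x = 1) (n : ℕ) (h : X → ℝ) :
    piExp R n (fun s => ∑ i, h (s i)) = n * ∑ x, R x * h x := by
  induction n with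
  | zero => simp [piExp]
  | succ n ih =>
    rw [piExp_succ]
    simp only [Fin.sum_univ_succ, Fin.cons_zero, Fin.cons_succ, piExp_add, piExp_const hR, ih,
      mul_add, Finset.sum_add_distrib, ← Finset.sum_mul, hR]
    push_cast; ring

theorem piExp_sq_sum_apply {R : X → ℝ} (hR : ∑ x, R x = 1) (n : ℕ) (h : X → ℝ) :
    piExp R n (fun s => (∑ i, h (s i)) ^ 2) =
      n * ∑ x, R x * h x ^ 2 + n * (n - 1) * (∑ x, R x * h x) ^ 2 := by
  induction n with
  | zero => simp [piExp]
  | succ n ih =>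
    rw [piExp_succ]
    have key : ∀ x, piExp R n (fun s => (∑ i, h ((Fin.cons x s : Fin (n + 1) → X) i)) ^ 2) =
        h x ^ 2 + ((2 * h x) * (n * ∑ x, R x * h x) +
          (n * ∑ x, R x * h x ^ 2 + n * (n - 1) * (∑ x, R x * h x) ^ 2)) := by
      intro x
      rw [← ih, ← piExp_sum_apply hR, ← piExp_const_mul, ← piExp_add]
      conv_rhs => rw [← piExp_const hR n (h x ^ 2), ← piExp_add]
      congr 1; funext s
      simp only [Fin.sum_univ_succ, Fin.cons_zero, Fin.cons_succ]; ring
    simp only [key, mul_add, Finset.sum_add_distrib, ← Finset.sum_mul, hR]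
    have : ∑ x, R x * (2 * h x * (n * ∑ x, R x * h x)) = 2 * n * (∑ x, R x * h x) ^ 2 := by
      rw [Finset.sum_congr rfl fun x _ => (by ring : R x * (2 * h x * (n * ∑ x, R x * h x)) =
        R x * h x * (2 * n * ∑ x, R x * h x)), ← Finset.sum_mul]
      ring
    rw [this]
    push_cast; ring

theorem piExp_sq_sum_apply_le {R : X → ℝ} (hR : ∑ x, R x = 1) (n : ℕ) (h : X → ℝ) :
    piExp R n (fun s => (∑ i, h (s i)) ^ 2) ≤
      n * ∑ x, R x * h x ^ 2 + n ^ 2 * (∑ x, R x * h x) ^ 2 := by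
  rw [piExp_sq_sum_apply hR]
  have : (0:ℝ) ≤ n * (∑ x, R x * h x) ^ 2 := by positivity
  nlinarith

theorem piExp_append (R : X → ℝ) {n m : ℕ} (f : (Fin (n + m) → X) → ℝ) :
    piExp R (n + m) f = piExp R n (fun s => piExp R m (fun t => f (Fin.append s t))) := by
  unfold piExp
  rw [← (Fin.appendEquiv n m).sum_comp, Fintype.sum_prod_type]
  refine Finset.sum_congr rfl fun s _ => ?_
  rw [Finset.mul_sum]
  refine Finset.sum_congr rfl fun t _ => ?_
  simp [Fin.appendEquiv, Fin.prod_univ_add, mul_assoc]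

/-- The probability that `x` is missed by the coordinates `f (s i)` with `i < m`. -/
theorem piExp_indicator_missed {R : X → ℝ} (hR : ∑ x, R x = 1) {n m : ℕ} (hm : m ≤ n)
    {Y : Type} [DecidableEq Y] (f : X → Y) (y : Y) :
    piExp R n (fun s => if ∀ i : Fin n, (i : ℕ) < m → f (s i) ≠ y then 1 else 0) =
      (1 - ∑ x, R x * if f x = y then 1 else 0) ^ m := by
  have h := piExp_prod R (n := n)
    (fun i x => if (i : ℕ) < m then (1 - if f x = y then 1 else 0) else 1)
  have e1 : ∀ i : Fin n, (∑ x, R x * (if (i : ℕ) < m then (1 - if f x = y then 1 else 0) else 1)) =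
      if (i : ℕ) < m then (1 - ∑ x, R x * if f x = y then 1 else 0) else 1 := by
    intro i
    split_ifs
    · simp only [mul_sub, Finset.sum_sub_distrib, mul_one, hR]
    · simp [hR]
  simp only [e1] at h
  rw [Finset.prod_ite, Finset.prod_const, Finset.prod_const_one, mul_one] at h
  have hc : (Finset.univ.filter fun i : Fin n => (i : ℕ) < m).card = m := by
    rw [Fin.card_filter_val_lt, min_eq_right hm]
  rw [hc] at h
  rw [← h]
  congr 1; funext s
  split_ifs with hs
  · symm; apply Finset.prod_eq_one
    intro i _
    split_ifs with h1 h2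
    · exact absurd h2 (hs i h1)
    · simp
    · rfl
  · push Not at hs
    obtain ⟨i, hi, hy⟩ := hs
    symm; apply Finset.prod_eq_zero (Finset.mem_univ i)
    simp [hi, hy]

end Expectation

section PairWeight

variable {Ω : Type}

/-- The weight function of the product of two finite distributions. -/
def pairWeight (p q : Ω → ℝ) (z : Ω × Ω) : ℝ := p z.1 * q z.2

variable [Fintype Ω]

theorem sum_pairWeight {p q : Ω → ℝ} (hp : ∑ x, p x = 1) (hq : ∑ x, q x = 1) :
    ∑ z, pairWeight p q z = 1 := by
  simp only [pairWeight, Fintype.sum_prod_type, ← Finset.mul_sum, hq, mul_one, hp]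

theorem sum_pairWeight_fst {p q : Ω → ℝ} (hq : ∑ x, q x = 1) (f : Ω → ℝ) :
    ∑ z, pairWeight p q z * f z.1 = ∑ x, p x * f x := by
  simp only [pairWeight, Fintype.sum_prod_type]
  refine Finset.sum_congr rfl fun x _ => ?_
  rw [← Finset.sum_mul, ← Finset.mul_sum, hq, mul_one]

theorem sum_pairWeight_snd {p q : Ω → ℝ} (hp : ∑ x, p x = 1) (f : Ω → ℝ) :
    ∑ z, pairWeight p q z * f z.2 = ∑ x, q x * f x := by
  simp only [pairWeight, Fintype.sum_prod_type_right]
  refine Finset.sum_congr rfl fun x _ => ?_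
  rw [← Finset.sum_mul, ← Finset.sum_mul, hp, one_mul]

end PairWeight

section Statistic

variable {Ω : Type} [DecidableEq Ω]

/-- The signed indicator `1[x = u] - 1[y = u]` of a pair `z = (x, y)`. -/
def signedInd (u : Ω) (z : Ω × Ω) : ℝ :=
  (if z.1 = u then 1 else 0) - (if z.2 = u then 1 else 0)

/-- The bilinear statistic estimating `n² ∑_{u ∈ W} (p u - q u)²` from two independent blocks. -/
def blockStat (W : Finset Ω) {n : ℕ} (s t : Fin n → Ω × Ω) : ℝ :=
  ∑ u ∈ W, (∑ i, signedInd u (s i)) * ∑ i, signedInd u (t i)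

theorem sum_mul_signedInd (W : Finset Ω) (t : Ω → ℝ) (z : Ω × Ω) :
    ∑ u ∈ W, t u * signedInd u z =
      (if z.1 ∈ W then t z.1 else 0) - (if z.2 ∈ W then t z.2 else 0) := by
  simp [signedInd, mul_sub, Finset.sum_sub_distrib]

theorem sum_sum_signedInd (W : Finset Ω) (t : Ω → ℝ) {n : ℕ} (s : Fin n → Ω × Ω) :
    ∑ u ∈ W, t u * ∑ i, signedInd u (s i) = ∑ i, ∑ u ∈ W, t u * signedInd u (s i) := by
  simp only [Finset.mul_sum]
  exact Finset.sum_comm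

theorem blockStat_eq (W : Finset Ω) {n : ℕ} (s t : Fin n → Ω × Ω) :
    blockStat W s t = ∑ i, ∑ u ∈ W, (∑ j, signedInd u (t j)) * signedInd u (s i) := by
  rw [← sum_sum_signedInd]
  exact Finset.sum_congr rfl fun u _ => mul_comm _ _

variable [Fintype Ω]

theorem sum_mul_ite_mem (W : Finset Ω) (p t : Ω → ℝ) :
    ∑ x, p x * (if x ∈ W then t x else 0) = ∑ x ∈ W, p x * t x := by
  simp [mul_ite]

theorem mean_sum_signedInd {p q : Ω → ℝ} (hp : ∑ x, p x = 1) (hq : ∑ x, q x = 1)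
    (W : Finset Ω) (t : Ω → ℝ) :
    ∑ z, pairWeight p q z * ∑ u ∈ W, t u * signedInd u z = ∑ u ∈ W, t u * (p u - q u) := by
  simp only [sum_mul_signedInd, mul_sub, Finset.sum_sub_distrib]
  rw [sum_pairWeight_fst hq (fun x => if x ∈ W then t x else 0),
    sum_pairWeight_snd hp (fun x => if x ∈ W then t x else 0), sum_mul_ite_mem, sum_mul_ite_mem]
  simp only [mul_comm]

theorem sq_sum_signedInd_le {p q : Ω → ℝ} (hp0 : ∀ x, 0 ≤ p x) (hq0 : ∀ x, 0 ≤ q x)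
    (hp : ∑ x, p x = 1) (hq : ∑ x, q x = 1) (W : Finset Ω) (t : Ω → ℝ) :
    ∑ z, pairWeight p q z * (∑ u ∈ W, t u * signedInd u z) ^ 2 ≤
      2 * ∑ u ∈ W, (p u + q u) * t u ^ 2 := by
  have h1 : ∀ z, pairWeight p q z * (∑ u ∈ W, t u * signedInd u z) ^ 2 ≤
      2 * (pairWeight p q z * (if z.1 ∈ W then t z.1 ^ 2 else 0)) +
      2 * (pairWeight p q z * (if z.2 ∈ W then t z.2 ^ 2 else 0)) := by
    intro z
    rw [sum_mul_signedInd]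
    have h0 : 0 ≤ pairWeight p q z := mul_nonneg (hp0 _) (hq0 _)
    have h2 : ((if z.1 ∈ W then t z.1 else 0) - (if z.2 ∈ W then t z.2 else 0)) ^ 2 ≤
        2 * (if z.1 ∈ W then t z.1 ^ 2 else 0) + 2 * (if z.2 ∈ W then t z.2 ^ 2 else 0) := by
      split_ifs <;> nlinarith [sq_nonneg (t z.1 + t z.2), sq_nonneg (t z.1), sq_nonneg (t z.2)]
    nlinarith [mul_le_mul_of_nonneg_left h2 h0]
  refine (Finset.sum_le_sum fun z _ => h1 z).trans (le_of_eq ?_)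
  rw [Finset.sum_add_distrib, ← Finset.mul_sum, ← Finset.mul_sum,
    sum_pairWeight_fst hq (fun x => if x ∈ W then t x ^ 2 else 0),
    sum_pairWeight_snd hp (fun x => if x ∈ W then t x ^ 2 else 0),
    sum_mul_ite_mem W p (fun x => t x ^ 2), sum_mul_ite_mem W q (fun x => t x ^ 2)]
  simp only [add_mul, Finset.sum_add_distrib]
  ring

variable {p q : Ω → ℝ}

theorem piExp_blockStat (hp : ∑ x, p x = 1) (hq : ∑ x, q x = 1) (W : Finset Ω) (n : ℕ) :
    piExp (pairWeight p q) n (fun t => piExp (pairWeight p q) n (fun s => blockStat W s t)) =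
      n ^ 2 * ∑ u ∈ W, (p u - q u) ^ 2 := by
  have hR := sum_pairWeight hp hq
  have hs : ∀ t : Fin n → Ω × Ω, piExp (pairWeight p q) n (fun s => blockStat W s t) =
      n * ∑ u ∈ W, (∑ j, signedInd u (t j)) * (p u - q u) := fun t => by
    simp only [blockStat_eq]
    rw [piExp_sum_apply hR n (fun z => ∑ u ∈ W, (∑ j, signedInd u (t j)) * signedInd u z),
      mean_sum_signedInd hp hq]
  simp only [hs, piExp_const_mul]
  have : ∀ t : Fin n → Ω × Ω, (∑ u ∈ W, (∑ j, signedInd u (t j)) * (p u - q u)) =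
      ∑ j, ∑ u ∈ W, (p u - q u) * signedInd u (t j) := fun t => by
    rw [← sum_sum_signedInd]
    exact Finset.sum_congr rfl fun u _ => mul_comm _ _
  simp only [this]
  rw [piExp_sum_apply hR n (fun z => ∑ u ∈ W, (p u - q u) * signedInd u z),
    mean_sum_signedInd hp hq]
  simp only [sq, mul_assoc]

theorem piExp_sq_blockStat_le (hp0 : ∀ x, 0 ≤ p x) (hq0 : ∀ x, 0 ≤ q x)
    (hp : ∑ x, p x = 1) (hq : ∑ x, q x = 1) (W : Finset Ω) (n : ℕ) :
    piExp (pairWeight p q) n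
        (fun t => piExp (pairWeight p q) n (fun s => blockStat W s t ^ 2)) ≤
      4 * n ^ 2 * ∑ u ∈ W, (p u + q u) ^ 2 + 4 * n ^ 3 * ∑ u ∈ W, (p u + q u) * (p u - q u) ^ 2 +
        (n ^ 2 * ∑ u ∈ W, (p u - q u) ^ 2) ^ 2 := by
  have hR := sum_pairWeight hp hq
  have hR0 : ∀ z, 0 ≤ pairWeight p q z := fun z => mul_nonneg (hp0 _) (hq0 _)
  have hsq : ∀ c : Ω → ℝ, ∀ W' : Finset Ω,
      piExp (pairWeight p q) n (fun t => (∑ u ∈ W', c u * ∑ j, signedInd u (t j)) ^ 2) ≤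
        2 * n * ∑ u ∈ W', (p u + q u) * c u ^ 2 + n ^ 2 * (∑ u ∈ W', c u * (p u - q u)) ^ 2 := by
    intro c W'
    simp only [sum_sum_signedInd]
    refine (piExp_sq_sum_apply_le hR n (fun z => ∑ u ∈ W', c u * signedInd u z)).trans ?_
    rw [mean_sum_signedInd hp hq]
    have := mul_le_mul_of_nonneg_left (sq_sum_signedInd_le hp0 hq0 hp hq W' c)
      (Nat.cast_nonneg (α := ℝ) n)
    linarith
  have hone : ∀ u, piExp (pairWeight p q) n (fun t => (∑ j, signedInd u (t j)) ^ 2) ≤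
      2 * n * (p u + q u) + n ^ 2 * (p u - q u) ^ 2 := by
    intro u
    simpa using hsq (fun _ => 1) {u}
  have hs : ∀ t, piExp (pairWeight p q) n (fun s => blockStat W s t ^ 2) ≤
      2 * n * ∑ u ∈ W, (p u + q u) * (∑ j, signedInd u (t j)) ^ 2 +
        n ^ 2 * (∑ u ∈ W, (p u - q u) * (∑ j, signedInd u (t j))) ^ 2 := by
    intro t
    have := hsq (fun u => ∑ j, signedInd u (t j)) W
    refine le_trans (le_of_eq ?_) (this.trans (le_of_eq ?_))
    · simp only [blockStat]
      congr 1; funext s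
      congr 1
      exact Finset.sum_congr rfl fun u _ => mul_comm _ _
    · congr 3
      exact Finset.sum_congr rfl fun u _ => mul_comm _ _
  refine (piExp_mono hR0 hs).trans ?_
  rw [piExp_add, piExp_const_mul, piExp_const_mul, piExp_sum]
  simp only [piExp_const_mul]
  have h1 : ∑ u ∈ W, (p u + q u) *
      piExp (pairWeight p q) n (fun t => (∑ j, signedInd u (t j)) ^ 2) ≤
      2 * n * ∑ u ∈ W, (p u + q u) ^ 2 + n ^ 2 * ∑ u ∈ W, (p u + q u) * (p u - q u) ^ 2 := by
    rw [Finset.mul_sum, Finset.mul_sum, ← Finset.sum_add_distrib]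
    refine Finset.sum_le_sum fun u _ => ?_
    have := mul_le_mul_of_nonneg_left (hone u) (add_nonneg (hp0 u) (hq0 u))
    linarith
  have h2 := hsq (fun u => p u - q u) W
  have h3 : ∑ u ∈ W, (p u - q u) * (p u - q u) = ∑ u ∈ W, (p u - q u) ^ 2 :=
    Finset.sum_congr rfl fun u _ => (sq _).symm
  rw [h3] at h2
  have h1' := mul_le_mul_of_nonneg_left h1 (by positivity : (0:ℝ) ≤ 2 * n)
  have h2' := mul_le_mul_of_nonneg_left h2 (by positivity : (0:ℝ) ≤ (n:ℝ) ^ 2)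
  linarith

end Statistic

section Bridge

theorem sum_toReal_pmf {Ω : Type} [Fintype Ω] (P : PMF Ω) : ∑ x, (P x).toReal = 1 := by
  rw [← ENNReal.toReal_sum (fun x _ => P.apply_ne_top x), ← tsum_fintype (L := .unconditional _),
    P.tsum_coe, ENNReal.toReal_one]

variable {Ω : Type} [MeasurableSpace Ω] [MeasurableSingletonClass Ω]

theorem iidLaw_singleton (P : PMF Ω) (N : ℕ) (s : Fin N → Ω) :
    iidLaw P N {s} = ENNReal.ofReal (∏ i, (P (s i)).toReal) := by
  unfold iidLaw
  rw [Measure.pi_singleton, ENNReal.ofReal_prod_of_nonneg fun _ _ => ENNReal.toReal_nonneg]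
  refine Finset.prod_congr rfl fun i _ => ?_
  rw [PMF.toMeasure_apply_singleton _ _ (MeasurableSet.singleton _),
    ENNReal.ofReal_toReal (P.apply_ne_top _)]

variable [Fintype Ω]

/-- The deterministic tester with decision rule `D` on the paired samples. -/
def ruleTester {N : ℕ} (D : (Fin N → Ω × Ω) → Bool) : Tester Ω N :=
  fun s t => PMF.pure (D fun i => (s i, t i))

theorem outputProb_ruleTester {N : ℕ} (D : (Fin N → Ω × Ω) → Bool) (P Q : PMF Ω) (b : Bool) :
    outputProb (ruleTester D) P Q b = ENNReal.ofReal
      (piExp (pairWeight (fun x => (P x).toReal) fun x => (Q x).toReal) N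
        fun z => if D z = b then 1 else 0) := by
  have : ∀ N, SigmaFinite (iidLaw Q N) := fun N => by unfold iidLaw; infer_instance
  have : ∀ N, SigmaFinite (iidLaw P N) := fun N => by unfold iidLaw; infer_instance
  unfold outputProb piExp
  rw [lintegral_fintype, ← (Equiv.arrowProdEquivProdArrow (Fin N) (fun _ => Ω) (fun _ => Ω)).sum_comp,
    ENNReal.ofReal_sum_of_nonneg]
  · refine Finset.sum_congr rfl fun z _ => ?_
    have h1 : ({(Equiv.arrowProdEquivProdArrow (Fin N) (fun _ => Ω) (fun _ => Ω)) z} :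
        Set ((Fin N → Ω) × (Fin N → Ω))) = {fun i => (z i).1} ×ˢ {fun i => (z i).2} := by
      rw [Set.singleton_prod_singleton]; rfl
    rw [h1, Measure.prod_prod, iidLaw_singleton, iidLaw_singleton, ← ENNReal.ofReal_mul
      (Finset.prod_nonneg fun _ _ => ENNReal.toReal_nonneg), ← Finset.prod_mul_distrib]
    simp only [ruleTester, Equiv.arrowProdEquivProdArrow, Equiv.coe_fn_mk, PMF.pure_apply,
      pairWeight]
    by_cases h : D z = b
    · simp [h]
    · simp [h, Ne.symm h]
  · intro z _
    refine mul_nonneg (Finset.prod_nonneg fun _ _ => ?_) (by dsimp only; split_ifs <;> norm_num)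
    exact mul_nonneg ENNReal.toReal_nonneg ENNReal.toReal_nonneg

/-- The decision rule on four concatenated blocks of samples. -/
def fourBlocks {X : Type} {n : ℕ}
    (D : (Fin n → X) → (Fin n → X) → (Fin n → X) → (Fin n → X) → Bool)
    (z : Fin (n + (n + (n + n))) → X) : Bool :=
  D (fun i => z (i.castAdd _)) (fun i => z ((i.castAdd _).natAdd n))
    (fun i => z (((i.castAdd _).natAdd n).natAdd n)) (fun i => z (((i.natAdd n).natAdd n).natAdd n))

theorem piExp_fourBlocks {X : Type} [Fintype X] (R : X → ℝ) {n : ℕ}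
    (D : (Fin n → X) → (Fin n → X) → (Fin n → X) → (Fin n → X) → Bool) (b : Bool) :
    piExp R (n + (n + (n + n))) (fun z => if fourBlocks D z = b then 1 else 0) =
      piExp R n fun s₁ => piExp R n fun s₂ => piExp R n fun s₃ => piExp R n fun s₄ =>
        if D s₁ s₂ s₃ s₄ = b then 1 else 0 := by
  simp only [piExp_append, fourBlocks, Fin.append_left, Fin.append_right]

/-- A decision rule on four blocks of `n` sample pairs that errs with probability at most `1/3`
yields a successful tester with `4 n` samples. -/
theorem exists_succeeds_of_fourBlocks {A C : Type} [Fintype A] [Fintype C] [MeasurableSpace A]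
    [MeasurableSpace C] [MeasurableSingletonClass A] [MeasurableSingletonClass C]
    (Δ : PMF (A × C) → PMF (A × C) → ℝ) (ε : ℝ) {n : ℕ}
    (D : (Fin n → (A × C) × (A × C)) → (Fin n → (A × C) × (A × C)) →
      (Fin n → (A × C) × (A × C)) → (Fin n → (A × C) × (A × C)) → Bool)
    (h : ∀ P Q : PMF (A × C), IsProduct Q → ∀ b : Bool,
      (b = false → P = Q) → (b = true → ε ≤ Δ P Q) →
      let R := pairWeight (fun x => (P x).toReal) (fun x => (Q x).toReal)
      (piExp R n fun s₁ => piExp R n fun s₂ => piExp R n fun s₃ => piExp R n fun s₄ =>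
        if D s₁ s₂ s₃ s₄ = b then 1 else 0) ≤ 1 / 3) :
    ∃ T : Tester (A × C) (n + (n + (n + n))), Succeeds Δ ε T := by
  refine ⟨ruleTester (fourBlocks D), fun P Q hQ => ?_⟩
  have key : ∀ b : Bool, (b = false → P = Q) → (b = true → ε ≤ Δ P Q) →
      2 / 3 ≤ outputProb (ruleTester (fourBlocks D)) P Q (!b) := by
    intro b h1 h2
    have hb := h P Q hQ b h1 h2
    simp only at hb
    rw [← piExp_fourBlocks] at hb
    rw [outputProb_ruleTester]
    have hR := sum_pairWeight (sum_toReal_pmf P) (sum_toReal_pmf Q)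
    have hsum := piExp_const hR (n + (n + (n + n))) 1
    have : (fun _ : Fin (n + (n + (n + n))) → (A × C) × (A × C) => (1:ℝ)) =
        fun z => (if fourBlocks D z = b then 1 else 0) + if fourBlocks D z = !b then 1 else 0 := by
      funext z
      cases fourBlocks D z <;> cases b <;> simp
    rw [this, piExp_add] at hsum
    have h23 : (2 / 3 : ℝ≥0∞) = ENNReal.ofReal (2 / 3) := by
      rw [ENNReal.ofReal_div_of_pos (by norm_num)]; simp
    rw [h23]
    exact ENNReal.ofReal_le_ofReal (by linarith)
  exact ⟨fun h1 => key false (fun _ => h1) (by simp), fun h2 => key true (by simp) (fun _ => h2)⟩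

end Bridge

section Unseen

variable {X Y : Type} [Fintype X] [Fintype Y] [DecidableEq Y]

/-- The symbols that do not occur among the first `m` of the values `f (s i)`. -/
def unseen (f : X → Y) {n : ℕ} (m : ℕ) (s : Fin n → X) : Finset Y :=
  Finset.univ.filter fun y => ∀ i : Fin n, (i : ℕ) < m → f (s i) ≠ y

theorem piExp_mem_unseen {R : X → ℝ} (hR : ∑ x, R x = 1) {f : X → Y} {r : Y → ℝ}
    (hr : ∀ y, (∑ x, R x * if f x = y then 1 else 0) = r y) {n m : ℕ} (hm : m ≤ n) (y : Y) :
    piExp R n (fun s => if y ∈ unseen f m s then 1 else 0) = (1 - r y) ^ m := by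
  rw [← hr y, ← piExp_indicator_missed hR hm]
  simp [unseen]

theorem piExp_notMem_unseen_le {R : X → ℝ} (hR : ∑ x, R x = 1) {f : X → Y} {r : Y → ℝ}
    (hr : ∀ y, (∑ x, R x * if f x = y then 1 else 0) = r y) {n m : ℕ} (hm : m ≤ n) (y : Y)
    (hy : r y ≤ 1) :
    piExp R n (fun s => if y ∈ unseen f m s then 0 else 1) ≤ m * r y := by
  have h1 := piExp_mem_unseen hR hr hm y
  have h2 := piExp_const hR n 1
  have : (fun _ : Fin n → X => (1:ℝ)) =
      fun s => (if y ∈ unseen f m s then 1 else 0) + if y ∈ unseen f m s then 0 else 1 := by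
    funext s; split_ifs <;> simp
  rw [this, piExp_add, h1] at h2
  have h3 := one_add_mul_le_pow (a := - r y) (by linarith) m
  rw [← sub_eq_add_neg] at h3
  linarith

theorem mul_one_sub_pow_le {r : ℝ} (h0 : 0 ≤ r) (h1 : r ≤ 1) (m : ℕ) :
    r * (1 - r) ^ m ≤ 1 / (m + 1) := by
  have hb := one_add_mul_le_pow (a := r) (by linarith) m
  have hp : 0 ≤ (1 - r) ^ m := pow_nonneg (by linarith) m
  have h2 : (1 + r) ^ m * (1 - r) ^ m ≤ 1 := by
    rw [← mul_pow]
    exact pow_le_one₀ (by nlinarith) (by nlinarith)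
  rw [le_div_iff₀ (by positivity)]
  nlinarith [mul_le_mul_of_nonneg_right hb hp]

theorem sq_mul_one_sub_pow_le {r : ℝ} (h0 : 0 ≤ r) (h1 : r ≤ 1) (m : ℕ) :
    r ^ 2 * (1 - r) ^ m ≤ 4 / (m + 1) ^ 2 := by
  have h := mul_one_sub_pow_le h0 h1 (m / 2)
  have hm : (1 - r) ^ m ≤ ((1 - r) ^ (m / 2)) ^ 2 := by
    rw [← pow_mul]
    exact pow_le_pow_of_le_one (by linarith) (by linarith) (by omega)
  have hc : (m : ℝ) + 1 ≤ 2 * (((m / 2 : ℕ) : ℝ) + 1) := by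
    have : m + 1 ≤ 2 * (m / 2 + 1) := by omega
    exact_mod_cast this
  have h3 : r * (1 - r) ^ (m / 2) ≤ 2 / (m + 1) := by
    refine h.trans ?_
    rw [div_le_div_iff₀ (by positivity) (by positivity)]
    linarith
  calc r ^ 2 * (1 - r) ^ m ≤ r ^ 2 * ((1 - r) ^ (m / 2)) ^ 2 := by gcongr
    _ = (r * (1 - r) ^ (m / 2)) ^ 2 := by ring
    _ ≤ (2 / (m + 1)) ^ 2 := by
      have : 0 ≤ (1 - r) ^ (m / 2) := pow_nonneg (by linarith) _
      gcongr
    _ = 4 / (m + 1) ^ 2 := by rw [div_pow]; norm_num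

/-- A bound on the expected squared mass of the symbols unseen in `k / 32` samples. -/
def unseenBound (k d : ℕ) : ℝ := 4096 * min (k : ℝ) d / k ^ 2

theorem piExp_sum_unseen_le {R : X → ℝ} (hR : ∑ x, R x = 1) {f : X → Y} {r : Y → ℝ}
    (hr : ∀ y, (∑ x, R x * if f x = y then 1 else 0) = r y) (h0 : ∀ y, 0 ≤ r y)
    (h1 : ∑ y, r y = 1) {n k : ℕ} (hk : 0 < k) (hkn : k ≤ n) :
    piExp R n (fun s => ∑ y ∈ unseen f (k / 32) s, r y ^ 2) ≤ unseenBound k (Fintype.card Y) := by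
  have hle : ∀ y, r y ≤ 1 := fun y =>
    h1 ▸ Finset.single_le_sum (fun y _ => h0 y) (Finset.mem_univ y)
  have hm : k / 32 ≤ n := (Nat.div_le_self _ _).trans hkn
  have hk' : (0:ℝ) < k := by exact_mod_cast hk
  have hmk : (k : ℝ) / 32 ≤ ((k / 32 : ℕ) : ℝ) + 1 := by
    have : k ≤ 32 * (k / 32 + 1) := by omega
    have h : (k : ℝ) ≤ 32 * (((k / 32 : ℕ) : ℝ) + 1) := by exact_mod_cast this
    linarith
  have e : piExp R n (fun s => ∑ y ∈ unseen f (k / 32) s, r y ^ 2) =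
      ∑ y, r y ^ 2 * (1 - r y) ^ (k / 32) := by
    simp only [← piExp_mem_unseen hR hr hm, ← piExp_const_mul, ← piExp_sum]
    congr 1; funext s
    simp
  rw [e]
  have b1 : ∑ y, r y ^ 2 * (1 - r y) ^ (k / 32) ≤ 32 / (k : ℝ) := by
    calc ∑ y, r y ^ 2 * (1 - r y) ^ (k / 32) ≤ ∑ y, r y * (32 / (k : ℝ)) := by
          refine Finset.sum_le_sum fun y _ => ?_
          rw [sq, mul_assoc]
          refine mul_le_mul_of_nonneg_left ((mul_one_sub_pow_le (h0 y) (hle y) _).trans ?_) (h0 y)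
          rw [div_le_div_iff₀ (by positivity) hk']
          linarith
      _ = 32 / k := by rw [← Finset.sum_mul, h1, one_mul]
  have b2 : ∑ y, r y ^ 2 * (1 - r y) ^ (k / 32) ≤
      Fintype.card Y * (4096 / (k : ℝ) ^ 2) := by
    calc ∑ y, r y ^ 2 * (1 - r y) ^ (k / 32) ≤ ∑ _y : Y, (4096 / (k : ℝ) ^ 2 : ℝ) := by
          refine Finset.sum_le_sum fun y _ => (sq_mul_one_sub_pow_le (h0 y) (hle y) _).trans ?_
          rw [div_le_div_iff₀ (by positivity) (by positivity)]
          have := pow_le_pow_left₀ (by positivity) hmk 2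
          rw [div_pow] at this
          linarith
      _ = Fintype.card Y * (4096 / (k : ℝ) ^ 2) := by simp
  unfold unseenBound
  rcases le_total (k : ℝ) (Fintype.card Y) with h | h
  · rw [min_eq_left h]
    refine b1.trans ?_
    rw [div_le_div_iff₀ hk' (by positivity)]
    nlinarith [sq_nonneg (k:ℝ)]
  · rw [min_eq_right h]
    refine b2.trans (le_of_eq ?_)
    ring

end Unseen

section Chebyshev

variable {Ω : Type} [DecidableEq Ω] [Fintype Ω] {p q : Ω → ℝ}

/-- When the two distributions agree, the statistic rarely exceeds the threshold. -/
theorem piExp_threshold_le (hq0 : ∀ x, 0 ≤ q x) (hq : ∑ x, q x = 1) (W : Finset Ω) (n : ℕ) {τ : ℝ}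
    (hτ : 0 < τ) :
    (piExp (pairWeight q q) n fun t => piExp (pairWeight q q) n fun s =>
        if τ ≤ blockStat W s t then 1 else 0) ≤ 16 * n ^ 2 / τ ^ 2 * ∑ u ∈ W, q u ^ 2 := by
  have hR0 : ∀ z, 0 ≤ pairWeight q q z := fun z => mul_nonneg (hq0 _) (hq0 _)
  have h := piExp_sq_blockStat_le hq0 hq0 hq hq W n
  have h2 : ∑ u ∈ W, (q u + q u) ^ 2 = 4 * ∑ u ∈ W, q u ^ 2 := by
    rw [Finset.mul_sum]; exact Finset.sum_congr rfl fun u _ => by ring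
  simp only [sub_self, ne_eq, OfNat.ofNat_ne_zero, not_false_eq_true, zero_pow, mul_zero,
    Finset.sum_const_zero, add_zero, h2] at h
  have h3 : ∀ s t : Fin n → Ω × Ω,
      (if τ ≤ blockStat W s t then (1:ℝ) else 0) ≤ 1 / τ ^ 2 * blockStat W s t ^ 2 := by
    intro s t
    split_ifs with hc
    · rw [one_div_mul_eq_div, one_le_div (by positivity)]
      exact pow_le_pow_left₀ hτ.le hc 2
    · positivity
  calc _ ≤ piExp (pairWeight q q) n fun t => piExp (pairWeight q q) n fun s =>
        1 / τ ^ 2 * blockStat W s t ^ 2 := piExp_mono hR0 fun t => piExp_mono hR0 fun s => h3 s t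
    _ = 1 / τ ^ 2 * piExp (pairWeight q q) n fun t => piExp (pairWeight q q) n fun s =>
        blockStat W s t ^ 2 := by simp only [piExp_const_mul]
    _ ≤ 1 / τ ^ 2 * (4 * n ^ 2 * (4 * ∑ u ∈ W, q u ^ 2)) := by gcongr
    _ = _ := by ring

theorem variance_numeric_bound {a b : ℝ} (ha : 200 ≤ a) (hb : 0 ≤ b) (hab : 4000 * b ≤ a ^ 2) :
    4 * (32 * b ^ 2 + 8 * a ^ 2 + 8 * b * a ^ 2 + 4 * a ^ 3) ≤ a ^ 4 / 10 := by
  have h1 : (4000 * b) ^ 2 ≤ a ^ 4 := by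
    have := pow_le_pow_left₀ (by positivity) hab 2
    rwa [← pow_mul] at this
  have h2 : 4000 * b * a ^ 2 ≤ a ^ 4 := by nlinarith [sq_nonneg a]
  have h3 : 200 * a ^ 3 ≤ a ^ 4 := by
    have : 0 ≤ a ^ 3 := by positivity
    nlinarith
  have h4 : 40000 * a ^ 2 ≤ a ^ 4 := by
    have : 0 ≤ a ^ 2 := by positivity
    nlinarith
  nlinarith

/-- When the two distributions are far on `W` in `ℓ²`, the statistic rarely stays below the
threshold. -/
theorem piExp_lt_threshold_le (hp0 : ∀ x, 0 ≤ p x) (hq0 : ∀ x, 0 ≤ q x)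
    (hp : ∑ x, p x = 1) (hq : ∑ x, q x = 1) (W : Finset Ω) (n : ℕ) {τ : ℝ}
    (h1 : 40000 ≤ (n:ℝ) ^ 2 * ∑ u ∈ W, (p u - q u) ^ 2)
    (h2 : 4000 * (n * √(∑ u ∈ W, q u ^ 2)) ≤ (n:ℝ) ^ 2 * ∑ u ∈ W, (p u - q u) ^ 2)
    (hτ : 2 * τ ≤ (n:ℝ) ^ 2 * ∑ u ∈ W, (p u - q u) ^ 2) :
    (piExp (pairWeight p q) n fun t => piExp (pairWeight p q) n fun s =>
        if τ ≤ blockStat W s t then 0 else 1) ≤ 1 / 10 := by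
  have hR0 : ∀ z, 0 ≤ pairWeight p q z := fun z => mul_nonneg (hp0 _) (hq0 _)
  have hR := sum_pairWeight hp hq
  have hE := piExp_blockStat hp hq W n
  have hV := piExp_sq_blockStat_le hp0 hq0 hp hq W n
  set M := ∑ u ∈ W, (p u - q u) ^ 2 with hM
  set V := ∑ u ∈ W, q u ^ 2 with hVdef
  have hM0 : 0 ≤ M := Finset.sum_nonneg fun _ _ => sq_nonneg _
  have hV0 : 0 ≤ V := Finset.sum_nonneg fun _ _ => sq_nonneg _
  have hθ : ∀ u ∈ W, |p u - q u| ≤ √M := fun u hu => by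
    apply Real.abs_le_sqrt
    exact Finset.single_le_sum (f := fun u => (p u - q u) ^ 2) (fun _ _ => sq_nonneg _) hu
  have hqV : ∀ u ∈ W, q u ≤ √V := fun u hu => by
    apply Real.le_sqrt_of_sq_le
    exact Finset.single_le_sum (f := fun u => q u ^ 2) (fun _ _ => sq_nonneg _) hu
  have s1 : ∑ u ∈ W, (p u + q u) ^ 2 ≤ 8 * V + 2 * M := by
    rw [hM, hVdef, Finset.mul_sum, Finset.mul_sum, ← Finset.sum_add_distrib]
    exact Finset.sum_le_sum fun u _ => by nlinarith [sq_nonneg (p u - 3 * q u)]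
  have s2 : ∑ u ∈ W, (p u + q u) * (p u - q u) ^ 2 ≤ (2 * √V + √M) * M := by
    rw [hM, Finset.mul_sum]
    refine Finset.sum_le_sum fun u hu => mul_le_mul_of_nonneg_right ?_ (sq_nonneg _)
    linarith [hθ u hu, hqV u hu, le_abs_self (p u - q u)]
  set μ := (n:ℝ) ^ 2 * M with hμ
  have hμ0 : 0 < μ := by linarith
  have h3 : ∀ s t : Fin n → Ω × Ω, (if τ ≤ blockStat W s t then (0:ℝ) else 1) ≤
      4 / μ ^ 2 * (blockStat W s t ^ 2 + (-(2 * μ) * blockStat W s t + μ ^ 2)) := by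
    intro s t
    have e : blockStat W s t ^ 2 + (-(2 * μ) * blockStat W s t + μ ^ 2) =
      (μ - blockStat W s t) ^ 2 := by ring
    rw [e]
    split_ifs with hc
    · positivity
    · push Not at hc
      rw [div_mul_eq_mul_div, one_le_div (by positivity)]
      have : μ / 2 ≤ μ - blockStat W s t := by linarith
      have := pow_le_pow_left₀ (by positivity) this 2
      linarith
  have hnum := variance_numeric_bound (a := n * √M) (b := n * √V) (by
      apply abs_le_of_sq_le_sq' _ (by positivity) |>.2
      rw [mul_pow, Real.sq_sqrt hM0]; linarith) (by positivity) (by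
      rw [mul_pow, Real.sq_sqrt hM0]; exact h2)
  have hMs := Real.sq_sqrt hM0
  have hVs := Real.sq_sqrt hV0
  have e4 : ((n:ℝ) * √M) ^ 4 = μ ^ 2 := by
    rw [hμ, show ((n:ℝ) * √M) ^ 4 = (n ^ 2 * (√M ^ 2)) ^ 2 by ring, hMs]
  have e3 : ((n:ℝ) * √M) ^ 3 = n ^ 3 * (√M * M) := by
    rw [show ((n:ℝ) * √M) ^ 3 = n ^ 3 * (√M * √M ^ 2) by ring, hMs]
  rw [e4, e3, mul_pow, mul_pow, hMs, hVs] at hnum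
  have hvar : 4 * (n:ℝ) ^ 2 * ∑ u ∈ W, (p u + q u) ^ 2 +
      4 * n ^ 3 * ∑ u ∈ W, (p u + q u) * (p u - q u) ^ 2 ≤ μ ^ 2 / 40 := by
    have a1 := mul_le_mul_of_nonneg_left s1 (by positivity : (0:ℝ) ≤ 4 * n ^ 2)
    have a2 := mul_le_mul_of_nonneg_left s2 (by positivity : (0:ℝ) ≤ 4 * n ^ 3)
    linarith
  calc _ ≤ piExp (pairWeight p q) n fun t => piExp (pairWeight p q) n fun s =>
        4 / μ ^ 2 * (blockStat W s t ^ 2 + (-(2 * μ) * blockStat W s t + μ ^ 2)) :=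
        piExp_mono hR0 fun t => piExp_mono hR0 fun s => h3 s t
    _ = 4 / μ ^ 2 * ((piExp (pairWeight p q) n fun t => piExp (pairWeight p q) n fun s =>
        blockStat W s t ^ 2) + (-(2 * μ) * μ + μ ^ 2)) := by
        rw [← hE]
        simp only [piExp_const_mul, piExp_add, piExp_const hR]
    _ ≤ 4 / μ ^ 2 * (μ ^ 2 / 40) := by
        gcongr
        linarith
    _ = 1 / 10 := by field_simp; norm_num

end Chebyshev

theorem unseenBound_pos {k d : ℕ} (hk : 0 < k) (hd : 0 < d) : 0 < unseenBound k d := by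
  unfold unseenBound
  have : (0:ℝ) < k := by exact_mod_cast hk
  have : (0:ℝ) < d := by exact_mod_cast hd
  positivity

theorem sqrt_unseenBound_mul (k l d d' : ℕ) :
    √(unseenBound k d * unseenBound l d') =
      4096 * (√(min (k:ℝ) d) * √(min (l:ℝ) d')) / (k * l) := by
  have h1 : (0:ℝ) ≤ min (k:ℝ) d := by positivity
  have h2 : (0:ℝ) ≤ min (l:ℝ) d' := by positivity
  have e : unseenBound k d * unseenBound l d' =
      (4096 * (√(min (k:ℝ) d) * √(min (l:ℝ) d')) / (k * l)) ^ 2 := by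
    rw [div_pow, mul_pow, mul_pow, Real.sq_sqrt h1, Real.sq_sqrt h2]
    unfold unseenBound
    rw [div_mul_div_comm, mul_pow]
    congr 1; ring
  rw [e, Real.sqrt_sq (by positivity)]

section Separation

/-- The chi-square type density `(x - y)² / (x + y)`. -/
def triDisc (x y : ℝ) : ℝ := (x - y) ^ 2 / (x + y)

variable {x y : ℝ}

theorem triDisc_mul_add (hx : 0 ≤ x) (hy : 0 ≤ y) : triDisc x y * (x + y) = (x - y) ^ 2 := by
  unfold triDisc
  rcases (add_nonneg hx hy).eq_or_lt with h | h
  · obtain rfl : x = 0 := by linarith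
    obtain rfl : y = 0 := by linarith
    simp
  · field_simp

theorem triDisc_nonneg (hx : 0 ≤ x) (hy : 0 ≤ y) : 0 ≤ triDisc x y := by
  unfold triDisc; positivity

theorem triDisc_le_abs (hx : 0 ≤ x) (hy : 0 ≤ y) : triDisc x y ≤ |x - y| := by
  refine div_le_of_le_mul₀ (add_nonneg hx hy) (abs_nonneg _) ?_
  rw [← sq_abs, sq]
  refine mul_le_mul_of_nonneg_left (abs_le.2 ⟨?_, ?_⟩) (abs_nonneg _) <;> linarith

theorem triDisc_le_add (hx : 0 ≤ x) (hy : 0 ≤ y) : triDisc x y ≤ x + y :=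
  (triDisc_le_abs hx hy).trans (abs_le.2 ⟨by linarith, by linarith⟩)

theorem sq_sqrt_sub_sqrt_le_triDisc (hx : 0 ≤ x) (hy : 0 ≤ y) :
    (√x - √y) ^ 2 ≤ triDisc x y := by
  unfold triDisc
  rcases (add_nonneg hx hy).eq_or_lt with h | h
  · obtain rfl : x = 0 := by linarith
    obtain rfl : y = 0 := by linarith
    simp
  · rw [le_div_iff₀ h]
    have ex := Real.sq_sqrt hx
    have ey := Real.sq_sqrt hy
    have : 0 ≤ √x * √y := by positivity
    have e : (x - y) ^ 2 = (√x - √y) ^ 2 * (√x + √y) ^ 2 := by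
      rw [← ex, ← ey]; ring_nf; simp only [ex, ey]
    rw [e]
    refine mul_le_mul_of_nonneg_left ?_ (sq_nonneg _)
    nlinarith

end Separation

section Numeric

variable {A C : Type} [DecidableEq A] [DecidableEq C]

theorem card_le_of_one_le_mul {Y : Type} [Fintype Y] {r : Y → ℝ} (h0 : ∀ y, 0 ≤ r y)
    (h1 : ∑ y, r y = 1) (T : Finset Y) {b : ℝ} (hb : 0 ≤ b) (hT : ∀ y ∈ T, 1 ≤ b * r y) :
    (T.card : ℝ) ≤ b := by
  calc (T.card : ℝ) = ∑ _y ∈ T, (1:ℝ) := by simp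
    _ ≤ ∑ y ∈ T, b * r y := Finset.sum_le_sum hT
    _ = b * ∑ y ∈ T, r y := by rw [Finset.mul_sum]
    _ ≤ b * 1 := by
      refine mul_le_mul_of_nonneg_left ?_ hb
      rw [← h1]
      exact Finset.sum_le_sum_of_subset_of_nonneg (Finset.subset_univ _) fun y _ _ => h0 y
    _ = b := mul_one b

theorem card_le_image_mul_image (S : Finset (A × C)) :
    S.card ≤ (S.image Prod.fst).card * (S.image Prod.snd).card := by
  rw [← Finset.card_product]
  refine Finset.card_le_card fun x hx => ?_
  exact Finset.mem_product.2 ⟨Finset.mem_image_of_mem _ hx, Finset.mem_image_of_mem _ hx⟩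

theorem sqrt_min_mul_min_le {l d : ℝ} (hl : 0 < l) :
    min l d * √(min l d) ≤ l * √d :=
  mul_le_mul (min_le_left _ _) (Real.sqrt_le_sqrt (min_le_right _ _)) (Real.sqrt_nonneg _) hl.le

/-- The lower bound on the `ℓ²` separation when one coordinate is at its lightest level. -/
theorem separation_of_card {n l d d' L e M m : ℝ} (hn : 0 < n) (hl : 0 < l) (hd : 0 < d)
    (hd' : 0 < d')
    (hcard : e ^ 2 ≤ d * (2 * min l d') * M)
    (h : 327680000 * L * (d * √d' * √m) ≤ n ^ 2 * e ^ 2) (hL : 0 ≤ L) :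
    40000 * L * (n * (4096 * (√m * √(min l d')) / (n * l))) ≤ n ^ 2 * M := by
  set r := min l d' with hr
  have hr0 : 0 < r := lt_min hl hd'
  have hrr : r * √r ≤ l * √d' := sqrt_min_mul_min_le hl
  have e1 : 40000 * L * (n * (4096 * (√m * √r) / (n * l))) = 163840000 * L * (√m * √r) / l := by
    field_simp; ring
  rw [e1, div_le_iff₀ hl]
  have h2 : 163840000 * L * √m * (2 * d) * (r * √r) ≤ 163840000 * L * √m * (2 * d) * (l * √d') :=
    mul_le_mul_of_nonneg_left hrr (by positivity)
  have h3 : n ^ 2 * e ^ 2 ≤ n ^ 2 * (d * (2 * r) * M) :=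
    mul_le_mul_of_nonneg_left hcard (by positivity)
  have h4 : 327680000 * L * (d * √d' * √m) * l ≤ n ^ 2 * (d * (2 * r) * M) * l :=
    mul_le_mul_of_nonneg_right (h.trans h3) hl.le
  refine le_of_mul_le_mul_right ?_ (by positivity : 0 < 2 * d * r)
  linarith

variable [Fintype A] [Fintype C]

/-- A large discrepancy at the scales `k`, `l` forces a large `ℓ²` separation. -/
theorem separation {p : A × C → ℝ} {qa : A → ℝ} {qc : C → ℝ} (hp0 : ∀ x, 0 ≤ p x)
    (ha0 : ∀ a, 0 ≤ qa a) (hc0 : ∀ c, 0 ≤ qc c) (ha1 : ∑ a, qa a = 1) (hc1 : ∑ c, qc c = 1)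
    {n k l : ℕ} (hk : 0 < k) (hl : 0 < l) (hkn : k ≤ n) (hln : l ≤ n)
    (hCA : Fintype.card C ≤ Fintype.card A) (hC : 0 < Fintype.card C) (hCn : Fintype.card C ≤ n)
    {ε L : ℝ} (hε : 0 < ε) (hL : 1 ≤ L)
    (hN : 2 ^ 61 * L ^ 6 * (Fintype.card A * √(Fintype.card C) * √(min (n:ℝ) (Fintype.card A))) ≤
      (n * ε) ^ 2)
    (S : Finset (A × C))
    (hS : ∀ x ∈ S, ε / (Fintype.card A * Fintype.card C) ≤ p x + qa x.1 * qc x.2)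
    (hSa : k < n → ∀ x ∈ S, 1 ≤ 2 * k * qa x.1) (hSc : l < n → ∀ x ∈ S, 1 ≤ 2 * l * qc x.2)
    (he : ε / (2 * L ^ 2) ≤ ∑ x ∈ S, triDisc (p x) (qa x.1 * qc x.2)) :
    40000 ≤ (n:ℝ) ^ 2 * ∑ x ∈ S, (p x - qa x.1 * qc x.2) ^ 2 ∧
    40000 * L * (n * √(unseenBound k (Fintype.card A) * unseenBound l (Fintype.card C))) ≤
      (n:ℝ) ^ 2 * ∑ x ∈ S, (p x - qa x.1 * qc x.2) ^ 2 := by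
  have hq0 : ∀ x : A × C, 0 ≤ qa x.1 * qc x.2 := fun x => mul_nonneg (ha0 _) (hc0 _)
  have hdA : (0:ℝ) < Fintype.card A := by exact_mod_cast hC.trans_le hCA
  have hdC : (0:ℝ) < Fintype.card C := by exact_mod_cast hC
  have hCA' : (Fintype.card C : ℝ) ≤ Fintype.card A := by exact_mod_cast hCA
  have hCn' : (Fintype.card C : ℝ) ≤ n := by exact_mod_cast hCn
  have hk' : (0:ℝ) < k := by exact_mod_cast hk
  have hl' : (0:ℝ) < l := by exact_mod_cast hl
  have hn' : (0:ℝ) < n := by exact_mod_cast hk.trans_le hkn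
  have cardA : ((S.image Prod.fst).card : ℝ) ≤ Fintype.card A := by
    exact_mod_cast Finset.card_le_univ _
  have cardC : ((S.image Prod.snd).card : ℝ) ≤ Fintype.card C := by
    exact_mod_cast Finset.card_le_univ _
  have cardA2 : k < n → ((S.image Prod.fst).card : ℝ) ≤ 2 * k := fun h =>
    card_le_of_one_le_mul ha0 ha1 _ (by positivity) fun y hy => by
      obtain ⟨x, hx, rfl⟩ := Finset.mem_image.1 hy
      exact hSa h x hx
  have cardC2 : l < n → ((S.image Prod.snd).card : ℝ) ≤ 2 * l := fun h =>
    card_le_of_one_le_mul hc0 hc1 _ (by positivity) fun y hy => by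
      obtain ⟨x, hx, rfl⟩ := Finset.mem_image.1 hy
      exact hSc h x hx
  have cardS : (S.card : ℝ) ≤ (S.image Prod.fst).card * (S.image Prod.snd).card := by
    exact_mod_cast card_le_image_mul_image S
  set M := ∑ x ∈ S, (p x - qa x.1 * qc x.2) ^ 2 with hMdef
  set dA : ℝ := (Fintype.card A : ℝ) with hdAdef
  set dC : ℝ := (Fintype.card C : ℝ) with hdCdef
  set e := ε / (2 * L ^ 2) with hedef
  have he0 : 0 < e := by positivity
  have hM0 : 0 ≤ M := Finset.sum_nonneg fun _ _ => sq_nonneg _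
  set m := min (n:ℝ) dA with hm
  have hmC : dC ≤ m := le_min hCn' hCA'
  have hm0 : 0 < m := hdC.trans_le hmC
  have hsC : √dC * √dC = dC := Real.mul_self_sqrt hdC.le
  have hsA : √dA * √dA = dA := Real.mul_self_sqrt hdA.le
  have hsm : √dC ≤ √m := Real.sqrt_le_sqrt hmC
  have hsCA : √dC ≤ √dA := Real.sqrt_le_sqrt hCA'
  have hsC0 : 0 ≤ √dC := Real.sqrt_nonneg _
  have hsA0 : 0 ≤ √dA := Real.sqrt_nonneg _
  have hsm0 : 0 ≤ √m := Real.sqrt_nonneg _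
  have hF1 : dA * dC ≤ dA * √dC * √m := by
    rw [mul_assoc]
    refine mul_le_mul_of_nonneg_left ?_ hdA.le
    calc dC = √dC * √dC := hsC.symm
      _ ≤ √dC * √m := by gcongr
  have hF2 : dC * √dA * √dC ≤ dA * √dC * √m := by
    have : dC * √dA ≤ dA * √m := by
      calc dC * √dA = √dA * (√dC * √dC) := by rw [hsC]; ring
        _ ≤ √dA * (√dA * √m) := by gcongr
        _ = dA * √m := by rw [← mul_assoc, hsA]
    calc dC * √dA * √dC ≤ dA * √m * √dC := by gcongr
      _ = _ := by ring
  set F := dA * √dC * √m with hF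
  have hF0 : 0 ≤ F := by positivity
  have hne : (n:ℝ) ^ 2 * e ^ 2 = (n * ε) ^ 2 / (4 * L ^ 4) := by
    rw [hedef]; field_simp; ring
  have hNe : 2 ^ 59 * L ^ 2 * F ≤ (n:ℝ) ^ 2 * e ^ 2 := by
    rw [hne, le_div_iff₀ (by positivity)]
    linarith
  have hNe1 : 327680000 * L * F ≤ (n:ℝ) ^ 2 * e ^ 2 := by
    refine le_trans ?_ hNe
    refine mul_le_mul_of_nonneg_right ?_ hF0
    nlinarith
  have hcard : e ^ 2 ≤ S.card * M := by
    have h1 : e ≤ ∑ x ∈ S, |p x - qa x.1 * qc x.2| :=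
      he.trans (Finset.sum_le_sum fun x _ => triDisc_le_abs (hp0 x) (hq0 x))
    have h2 := sq_sum_le_card_mul_sum_sq (s := S) (f := fun x => |p x - qa x.1 * qc x.2|)
    simp only [sq_abs] at h2
    exact (pow_le_pow_left₀ he0.le h1 2).trans h2
  have lower : ∀ b : ℝ, 0 ≤ b → (∀ x ∈ S, b ≤ p x + qa x.1 * qc x.2) → b * e ≤ M := by
    intro b hb hbS
    calc b * e ≤ b * ∑ x ∈ S, triDisc (p x) (qa x.1 * qc x.2) := by gcongr
      _ = ∑ x ∈ S, b * triDisc (p x) (qa x.1 * qc x.2) := Finset.mul_sum _ _ _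
      _ ≤ M := Finset.sum_le_sum fun x hx => by
        rw [← triDisc_mul_add (hp0 x) (hq0 x), mul_comm]
        exact mul_le_mul_of_nonneg_left (hbS x hx) (triDisc_nonneg (hp0 x) (hq0 x))
  refine ⟨?_, ?_⟩
  · have h1 := lower _ (by positivity) hS
    have h2 : ε / (dA * dC) * e = ε ^ 2 / (2 * L ^ 2 * (dA * dC)) := by
      rw [hedef]; field_simp
    rw [h2, div_le_iff₀ (by positivity)] at h1
    have h3 : 2 ^ 61 * L ^ 6 * (dA * dC) ≤ (n * ε) ^ 2 :=
      (mul_le_mul_of_nonneg_left hF1 (by positivity)).trans hN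
    have h4 : (n * ε) ^ 2 ≤ n ^ 2 * M * (2 * L ^ 2 * (dA * dC)) := by
      rw [mul_pow, mul_assoc]
      exact mul_le_mul_of_nonneg_left h1 (by positivity)
    have h5 : L ^ 2 * (dA * dC) ≤ L ^ 6 * (dA * dC) := by
      refine mul_le_mul_of_nonneg_right (pow_le_pow_right₀ hL (by norm_num)) (by positivity)
    have h6 : 0 < L ^ 2 * (dA * dC) := by positivity
    refine le_of_mul_le_mul_right ?_ h6
    linarith
  · rw [sqrt_unseenBound_mul]
    rcases hkn.eq_or_lt with hkn | hkn
    · subst hkn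
      refine separation_of_card hk' hl' hdA hdC ?_ hNe1 (by linarith)
      refine hcard.trans (mul_le_mul_of_nonneg_right (cardS.trans ?_) hM0)
      refine mul_le_mul cardA ?_ (by positivity) hdA.le
      rw [mul_min_of_nonneg _ _ (by norm_num : (0:ℝ) ≤ 2)]
      refine le_min ?_ (by linarith)
      rcases hln.eq_or_lt with hln | hln
      · subst hln; linarith
      · exact cardC2 hln
    rcases hln.eq_or_lt with hln | hln
    · subst hln
      have := separation_of_card (n := l) (l := k) (d := dC) (d' := dA) (L := L) (e := e) (M := M)
        (m := min (l:ℝ) dC) hl' hk' hdC hdA ?_ ?_ (by linarith)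
      · rw [mul_comm √(min (l:ℝ) dC), mul_comm (l:ℝ) k] at this
        exact this
      · refine hcard.trans (mul_le_mul_of_nonneg_right (cardS.trans ?_) hM0)
        rw [mul_comm]
        refine mul_le_mul cardC ?_ (by positivity) hdC.le
        rw [mul_min_of_nonneg _ _ (by norm_num : (0:ℝ) ≤ 2)]
        exact le_min (cardA2 hkn) (by linarith)
      · refine le_trans ?_ hNe1
        rw [min_eq_right hCn']
        gcongr
    · have h1 := lower (1 / (4 * (k * l))) (by positivity) fun x hx => by
        rw [div_le_iff₀ (by positivity)]
        have h2 := mul_le_mul (hSa hkn x hx) (hSc hln x hx) zero_le_one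
          (mul_nonneg (by positivity) (ha0 _))
        have := mul_nonneg (hp0 x) (by positivity : (0:ℝ) ≤ 4 * (k * l))
        linarith
      have hr : √(min (k:ℝ) dA) * √(min (l:ℝ) dC) ≤ √dA * √dC :=
        mul_le_mul (Real.sqrt_le_sqrt (min_le_right _ _)) (Real.sqrt_le_sqrt (min_le_right _ _))
          (Real.sqrt_nonneg _) hsA0
      have h3 : 1310720000 * L ^ 3 * (√dA * √dC) ≤ n * ε := by
        refine abs_le_of_sq_le_sq' ?_ (by positivity) |>.2
        refine le_trans ?_ hN
        have e2 : (1310720000 * L ^ 3 * (√dA * √dC)) ^ 2 =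
            1310720000 ^ 2 * L ^ 6 * (dA * dC) := by
          rw [mul_pow, mul_pow, mul_pow, Real.sq_sqrt hdA.le, Real.sq_sqrt hdC.le]; ring
        rw [e2]
        gcongr
        norm_num
      have h4 : 655360000 * L * (√dA * √dC) ≤ n * e := by
        have e3 : (n:ℝ) * e = n * ε / (2 * L ^ 2) := by rw [hedef]; ring
        rw [e3, le_div_iff₀ (by positivity)]
        linarith
      rw [one_div_mul_eq_div, div_le_iff₀ (by positivity)] at h1
      have e1 : 40000 * L * (n * (4096 * (√(min (k:ℝ) dA) * √(min (l:ℝ) dC)) / (k * l))) =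
          n * (163840000 * L * (√(min (k:ℝ) dA) * √(min (l:ℝ) dC))) / (k * l) := by
        field_simp; ring
      rw [e1, div_le_iff₀ (by positivity)]
      have h5 : 163840000 * L * (√(min (k:ℝ) dA) * √(min (l:ℝ) dC)) ≤
          163840000 * L * (√dA * √dC) := mul_le_mul_of_nonneg_left hr (by positivity)
      have h6 : 163840000 * L * (√(min (k:ℝ) dA) * √(min (l:ℝ) dC)) ≤ n * (M * (k * l)) := by
        have := mul_le_mul_of_nonneg_left h1 hn'.le
        linarith
      have := mul_le_mul_of_nonneg_left h6 hn'.le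
      linarith

end Numeric

section Rule

variable {A C : Type} [Fintype A] [Fintype C]

/-- The bound on the expected squared mass of `unseenRect`. -/
def rectBound (A C : Type) [Fintype A] [Fintype C] (k l : ℕ) : ℝ :=
  unseenBound k (Fintype.card A) * unseenBound l (Fintype.card C)

/-- The rejection threshold at the scales `k`, `l`. -/
def threshold (A C : Type) [Fintype A] [Fintype C] (I k l : ℕ) : ℝ :=
  30 * (I + 1) * (2 ^ I * √(rectBound A C k l))

theorem rectBound_pos [Nonempty A] [Nonempty C] {k l : ℕ} (hk : 0 < k) (hl : 0 < l) :
    0 < rectBound A C k l :=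
  mul_pos (unseenBound_pos hk Fintype.card_pos) (unseenBound_pos hl Fintype.card_pos)

variable {p : A × C → ℝ} {qa : A → ℝ} {qc : C → ℝ}

theorem sum_mul_eq_one (ha1 : ∑ a, qa a = 1) (hc1 : ∑ c, qc c = 1) :
    ∑ x : A × C, qa x.1 * qc x.2 = 1 := by
  rw [Fintype.sum_prod_type]
  simp only [← Finset.mul_sum, hc1, mul_one, ha1]

theorem marginal_fst [DecidableEq A] (hp : ∑ x, p x = 1) (hc1 : ∑ c, qc c = 1) (a : A) :
    (∑ z, pairWeight p (fun x => qa x.1 * qc x.2) z * if z.2.1 = a then 1 else 0) = qa a := by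
  rw [sum_pairWeight_snd hp (fun x : A × C => if x.1 = a then (1:ℝ) else 0)]
  simp only [Fintype.sum_prod_type, mul_ite, mul_one, mul_zero]
  rw [Finset.sum_eq_single a]
  · simp [← Finset.mul_sum, hc1]
  · intro b _ hb; simp [hb]
  · simp

theorem marginal_snd [DecidableEq C] (hp : ∑ x, p x = 1) (ha1 : ∑ a, qa a = 1) (c : C) :
    (∑ z, pairWeight p (fun x => qa x.1 * qc x.2) z * if z.2.2 = c then 1 else 0) = qc c := by
  rw [sum_pairWeight_snd hp (fun x : A × C => if x.2 = c then (1:ℝ) else 0)]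
  simp only [Fintype.sum_prod_type_right, mul_ite, mul_one, mul_zero]
  rw [Finset.sum_eq_single c]
  · simp [← Finset.sum_mul, ha1]
  · intro b _ hb; simp [hb]
  · simp

variable [DecidableEq A] [DecidableEq C]

/-- The rectangle of symbols unseen in the second components of the two auxiliary blocks. -/
def unseenRect {n : ℕ} (k l : ℕ) (s₁ s₂ : Fin n → (A × C) × (A × C)) : Finset (A × C) :=
  unseen (fun z => z.2.1) (k / 32) s₁ ×ˢ unseen (fun z => z.2.2) (l / 32) s₂

open Classical in
/-- The decision rule: accept unless some dyadic rectangle shows a large statistic. -/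
def acceptRule (I : ℕ) (s₁ s₂ t s : Fin (2 ^ I) → (A × C) × (A × C)) : Bool :=
  decide (∀ i j : Fin (I + 1),
    blockStat (unseenRect (2 ^ (i : ℕ)) (2 ^ (j : ℕ)) s₁ s₂) s t <
      threshold A C I (2 ^ (i : ℕ)) (2 ^ (j : ℕ)))

theorem sum_sq_unseenRect {n : ℕ} (k l : ℕ) (s₁ s₂ : Fin n → (A × C) × (A × C)) :
    ∑ x ∈ unseenRect k l s₁ s₂, (qa x.1 * qc x.2) ^ 2 =
      (∑ a ∈ unseen (fun z => z.2.1) (k / 32) s₁, qa a ^ 2) *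
        ∑ c ∈ unseen (fun z => z.2.2) (l / 32) s₂, qc c ^ 2 := by
  rw [unseenRect, Finset.sum_product, Finset.sum_mul_sum]
  simp only [mul_pow]

theorem piExp_sum_sq_unseenRect_le (hp0 : ∀ x, 0 ≤ p x) (ha0 : ∀ a, 0 ≤ qa a)
    (hc0 : ∀ c, 0 ≤ qc c) (hp : ∑ x, p x = 1) (ha1 : ∑ a, qa a = 1) (hc1 : ∑ c, qc c = 1)
    {n k l : ℕ} (hk : 0 < k) (hl : 0 < l) (hkn : k ≤ n) (hln : l ≤ n) :
    (piExp (pairWeight p fun x => qa x.1 * qc x.2) n fun s₁ =>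
      piExp (pairWeight p fun x => qa x.1 * qc x.2) n fun s₂ =>
        ∑ x ∈ unseenRect k l s₁ s₂, (qa x.1 * qc x.2) ^ 2) ≤ rectBound A C k l := by
  set R := pairWeight p fun x : A × C => qa x.1 * qc x.2 with hRdef
  have hR : ∑ z, R z = 1 := sum_pairWeight hp (sum_mul_eq_one ha1 hc1)
  have hR0 : ∀ z, 0 ≤ R z := fun z => mul_nonneg (hp0 _) (mul_nonneg (ha0 _) (hc0 _))
  have h1 := piExp_sum_unseen_le hR (marginal_fst hp hc1) ha0 ha1 hk hkn
  have h2 := piExp_sum_unseen_le hR (marginal_snd hp ha1) hc0 hc1 hl hln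
  have h20 : 0 ≤ piExp R n fun s₂ => ∑ c ∈ unseen (fun z => z.2.2) (l / 32) s₂, qc c ^ 2 := by
    rw [← piExp_const hR n 0]
    exact piExp_mono hR0 fun s => Finset.sum_nonneg fun _ _ => sq_nonneg _
  simp only [sum_sq_unseenRect, piExp_const_mul]
  rw [show ∀ (f : (Fin n → (A × C) × (A × C)) → ℝ) (c : ℝ),
    piExp R n (fun s => f s * c) = piExp R n f * c from fun f c => by
      simp only [mul_comm _ c, piExp_const_mul]]
  refine mul_le_mul h1 h2 h20 ?_
  unfold unseenBound; positivity

theorem completeness [Nonempty A] [Nonempty C] (ha0 : ∀ a, 0 ≤ qa a)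
    (hc0 : ∀ c, 0 ≤ qc c) (ha1 : ∑ a, qa a = 1) (hc1 : ∑ c, qc c = 1) (I : ℕ) :
    let q := fun x : A × C => qa x.1 * qc x.2
    (piExp (pairWeight q q) (2 ^ I) fun s₁ => piExp (pairWeight q q) (2 ^ I) fun s₂ =>
      piExp (pairWeight q q) (2 ^ I) fun t => piExp (pairWeight q q) (2 ^ I) fun s =>
        if acceptRule I s₁ s₂ t s = false then 1 else 0) ≤ 1 / 3 := by
  intro q
  have hq0 : ∀ x, 0 ≤ q x := fun x => mul_nonneg (ha0 _) (hc0 _)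
  have hq : ∑ x, q x = 1 := sum_mul_eq_one ha1 hc1
  set R := pairWeight q q with hRdef
  have hR : ∑ z, R z = 1 := sum_pairWeight hq hq
  have hR0 : ∀ z, 0 ≤ R z := fun z => mul_nonneg (hq0 _) (hq0 _)
  have hunion : ∀ s₁ s₂ t s : Fin (2 ^ I) → (A × C) × (A × C),
      (if acceptRule I s₁ s₂ t s = false then (1:ℝ) else 0) ≤
        ∑ i : Fin (I + 1), ∑ j : Fin (I + 1),
          if threshold A C I (2 ^ (i : ℕ)) (2 ^ (j : ℕ)) ≤
            blockStat (unseenRect (2 ^ (i : ℕ)) (2 ^ (j : ℕ)) s₁ s₂) s t then 1 else 0 := by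
    intro s₁ s₂ t s
    split_ifs with h
    · simp only [acceptRule, decide_eq_false_iff_not] at h
      push Not at h
      obtain ⟨i, j, hij⟩ := h
      refine le_trans ?_ (Finset.single_le_sum (fun i _ => Finset.sum_nonneg fun j _ => ?_)
        (Finset.mem_univ i))
      · refine le_trans ?_ (Finset.single_le_sum (fun j _ => ?_) (Finset.mem_univ j))
        · rw [if_pos hij]
        · split_ifs <;> norm_num
      · split_ifs <;> norm_num
    · exact Finset.sum_nonneg fun i _ => Finset.sum_nonneg fun j _ => by split_ifs <;> norm_num
  refine (piExp_mono hR0 fun s₁ => piExp_mono hR0 fun s₂ => piExp_mono hR0 fun t =>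
    piExp_mono hR0 fun s => hunion s₁ s₂ t s).trans ?_
  simp only [piExp_sum]
  have hone : ∀ i j : Fin (I + 1),
      (piExp R (2 ^ I) fun s₁ => piExp R (2 ^ I) fun s₂ =>
        piExp R (2 ^ I) fun t => piExp R (2 ^ I) fun s =>
          if threshold A C I (2 ^ (i : ℕ)) (2 ^ (j : ℕ)) ≤
            blockStat (unseenRect (2 ^ (i : ℕ)) (2 ^ (j : ℕ)) s₁ s₂) s t then 1 else 0) ≤
      16 / (900 * ((I:ℝ) + 1) ^ 2) := by
    intro i j
    have hU : 0 < rectBound A C (2 ^ (i : ℕ)) (2 ^ (j : ℕ)) :=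
      rectBound_pos (by positivity) (by positivity)
    have hτ : 0 < threshold A C I (2 ^ (i : ℕ)) (2 ^ (j : ℕ)) := by
      unfold threshold
      have := Real.sqrt_pos.2 hU
      positivity
    have h1 := piExp_sum_sq_unseenRect_le hq0 ha0 hc0 hq ha1 hc1 (n := 2 ^ I)
      (k := 2 ^ (i : ℕ)) (l := 2 ^ (j : ℕ)) (by positivity) (by positivity)
      (Nat.pow_le_pow_right (by norm_num) (by omega)) (Nat.pow_le_pow_right (by norm_num) (by omega))
    refine (piExp_mono hR0 fun s₁ => piExp_mono hR0 fun s₂ =>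
      piExp_threshold_le hq0 hq _ _ hτ).trans ?_
    simp only [piExp_const_mul]
    refine (mul_le_mul_of_nonneg_left h1 (by positivity)).trans (le_of_eq ?_)
    unfold threshold
    rw [mul_pow, mul_pow, mul_pow, Real.sq_sqrt hU.le]
    push_cast
    field_simp
    ring
  refine (Finset.sum_le_sum fun i _ => Finset.sum_le_sum fun j _ => hone i j).trans ?_
  simp only [Finset.sum_const, Finset.card_univ, Fintype.card_fin, nsmul_eq_mul]
  push_cast
  rw [show ((I:ℝ) + 1) * ((I + 1) * (16 / (900 * ((I:ℝ) + 1) ^ 2))) = 16 / 900 by field_simp]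
  norm_num

theorem exists_dyadic_level {r : ℝ} (h1 : r ≤ 1) (I : ℕ) :
    ∃ i : Fin (I + 1), r * 2 ^ (i : ℕ) ≤ 1 ∧ ((i : ℕ) < I → 1 ≤ 2 * 2 ^ (i : ℕ) * r) := by
  classical
  refine ⟨⟨Nat.findGreatest (fun i => r * 2 ^ i ≤ 1) I,
    Nat.lt_succ_of_le (Nat.findGreatest_le I)⟩, ?_, fun h => ?_⟩
  · exact Nat.findGreatest_spec (P := fun i => r * 2 ^ i ≤ 1) (Nat.zero_le I) (by simpa using h1)
  · have := Nat.findGreatest_is_greatest (P := fun i => r * 2 ^ i ≤ 1) (Nat.lt_succ_self _) h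
    push Not at this
    rw [Nat.succ_eq_add_one, pow_succ] at this
    dsimp only
    linarith

/-- Two distributions far in Hellinger distance have a large discrepancy on the symbols of
non-negligible mass. -/
theorem le_sum_triDisc_of_hellinger {Ω : Type} [Fintype Ω] [Nonempty Ω] {p q : Ω → ℝ}
    (hp0 : ∀ x, 0 ≤ p x) (hq0 : ∀ x, 0 ≤ q x) {ε : ℝ}
    (h : ε ≤ 1 / 2 * ∑ x, (√(p x) - √(q x)) ^ 2) :
    ε ≤ ∑ x with ε / Fintype.card Ω ≤ p x + q x, triDisc (p x) (q x) := by
  have h1 : 2 * ε ≤ ∑ x, triDisc (p x) (q x) := by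
    have := Finset.sum_le_sum (s := Finset.univ)
      fun x _ => sq_sqrt_sub_sqrt_le_triDisc (hp0 x) (hq0 x)
    linarith
  have hε : ∑ _x : Ω, ε / Fintype.card Ω = ε := by
    simp
    field_simp
  have h2 : ∑ x, triDisc (p x) (q x) ≤
      ∑ x, ((if ε / Fintype.card Ω ≤ p x + q x then triDisc (p x) (q x) else 0) +
        max (ε / Fintype.card Ω) 0) := by
    refine Finset.sum_le_sum fun x _ => ?_
    split_ifs with hx
    · linarith [le_max_right (ε / Fintype.card Ω) 0]
    · linarith [triDisc_le_add (hp0 x) (hq0 x), le_max_left (ε / Fintype.card Ω) 0]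
  rcases le_total ε 0 with h0 | h0
  · exact h0.trans (Finset.sum_nonneg fun x _ => triDisc_nonneg (hp0 x) (hq0 x))
  · rw [max_eq_left (by positivity), Finset.sum_add_distrib, hε, ← Finset.sum_filter] at h2
    linarith

theorem soundness (hp0 : ∀ x, 0 ≤ p x) (ha0 : ∀ a, 0 ≤ qa a)
    (hc0 : ∀ c, 0 ≤ qc c) (hp : ∑ x, p x = 1) (ha1 : ∑ a, qa a = 1) (hc1 : ∑ c, qc c = 1) (I : ℕ)
    [Nonempty A] [Nonempty C]
    (hCA : Fintype.card C ≤ Fintype.card A) (hCn : Fintype.card C ≤ 2 ^ I)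
    {ε : ℝ} (hε : 0 < ε)
    (hN : 2 ^ 61 * ((I:ℝ) + 1) ^ 6 * (Fintype.card A * √(Fintype.card C) *
      √(min ((2:ℝ) ^ I) (Fintype.card A))) ≤ (2 ^ I * ε) ^ 2)
    (hfar : ε ≤ 1 / 2 * ∑ x, (√(p x) - √(qa x.1 * qc x.2)) ^ 2) :
    let R := pairWeight p fun x : A × C => qa x.1 * qc x.2
    (piExp R (2 ^ I) fun s₁ => piExp R (2 ^ I) fun s₂ =>
      piExp R (2 ^ I) fun t => piExp R (2 ^ I) fun s =>
        if acceptRule I s₁ s₂ t s = true then 1 else 0) ≤ 1 / 3 := by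
  intro R
  have hq0 : ∀ x : A × C, 0 ≤ qa x.1 * qc x.2 := fun x => mul_nonneg (ha0 _) (hc0 _)
  have hq : ∑ x : A × C, qa x.1 * qc x.2 = 1 := sum_mul_eq_one ha1 hc1
  have hR : ∑ z, R z = 1 := sum_pairWeight hp hq
  have hR0 : ∀ z, 0 ≤ R z := fun z => mul_nonneg (hp0 _) (hq0 _)
  have ha_le : ∀ a, qa a ≤ 1 := fun a =>
    ha1 ▸ Finset.single_le_sum (fun y _ => ha0 y) (Finset.mem_univ a)
  have hc_le : ∀ c, qc c ≤ 1 := fun c =>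
    hc1 ▸ Finset.single_le_sum (fun y _ => hc0 y) (Finset.mem_univ c)
  choose levA hA1 hA2 using fun a => exists_dyadic_level (ha_le a) I
  choose levC hC1 hC2 using fun c => exists_dyadic_level (hc_le c) I
  set g : A × C → ℝ := fun x => triDisc (p x) (qa x.1 * qc x.2) with hg
  have hg0 : ∀ x, 0 ≤ g x := fun x => triDisc_nonneg (hp0 x) (hq0 x)
  set G : Finset (A × C) := Finset.univ.filter fun x =>
    ε / Fintype.card (A × C) ≤ p x + qa x.1 * qc x.2 with hG
  have hsumG : ε ≤ ∑ x ∈ G, g x := le_sum_triDisc_of_hellinger hp0 hq0 hfar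
  obtain ⟨⟨i, j⟩, -, hij⟩ := Finset.exists_le_sum_fiber_of_maps_to_of_nsmul_le_sum
    (s := G) (t := (Finset.univ : Finset (Fin (I + 1) × Fin (I + 1))))
    (f := fun x => (levA x.1, levC x.2)) (w := g) (b := ε / ((I:ℝ) + 1) ^ 2)
    (fun _ _ => Finset.mem_univ _) Finset.univ_nonempty (by
      rw [Finset.card_univ, Fintype.card_prod, Fintype.card_fin, nsmul_eq_mul]
      push_cast
      rw [← sq, mul_div_cancel₀ _ (by positivity)]
      exact hsumG)
  set H := G.filter fun x => (levA x.1, levC x.2) = (i, j) with hH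
  set G0 := ∑ x ∈ H, g x with hG0
  have hG0pos : 0 < G0 := lt_of_lt_of_le (by positivity) hij
  have hHmem : ∀ x ∈ H, ε / Fintype.card (A × C) ≤ p x + qa x.1 * qc x.2 ∧
      levA x.1 = i ∧ levC x.2 = j := by
    intro x hx
    simpa [hH, hG] using hx
  set k : ℕ := 2 ^ (i : ℕ) with hk
  set l : ℕ := 2 ^ (j : ℕ) with hl
  have hk0 : 0 < k := by positivity
  have hl0 : 0 < l := by positivity
  have hkn : k ≤ 2 ^ I := Nat.pow_le_pow_right (by norm_num) (by omega)
  have hln : l ≤ 2 ^ I := Nat.pow_le_pow_right (by norm_num) (by omega)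
  have hU : 0 < rectBound A C k l := rectBound_pos hk0 hl0
  let loss : (Fin (2 ^ I) → (A × C) × (A × C)) → (Fin (2 ^ I) → (A × C) × (A × C)) → ℝ :=
    fun s₁ s₂ => ∑ x ∈ H, g x * ((if x.1 ∈ unseen (fun z => z.2.1) (k / 32) s₁ then 0 else 1) +
      if x.2 ∈ unseen (fun z => z.2.2) (l / 32) s₂ then 0 else 1)
  have hloss0 : ∀ s₁ s₂, 0 ≤ loss s₁ s₂ := fun s₁ s₂ => Finset.sum_nonneg fun x _ =>
    mul_nonneg (hg0 x) (by split_ifs <;> norm_num)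
  have hEloss : (piExp R (2 ^ I) fun s₁ => piExp R (2 ^ I) fun s₂ => loss s₁ s₂) ≤ G0 / 16 := by
    simp only [loss, piExp_sum, piExp_const_mul, piExp_add, piExp_const hR]
    rw [hG0, Finset.sum_div]
    refine Finset.sum_le_sum fun x hx => ?_
    rw [div_eq_mul_inv]
    refine mul_le_mul_of_nonneg_left ?_ (hg0 x)
    have small : ∀ (r : ℝ) (k : ℕ), 0 ≤ r → r * k ≤ 1 → ((k / 32 : ℕ) : ℝ) * r ≤ 1 / 32 := by
      intro r k hr hrk
      have : ((k / 32 : ℕ) : ℝ) ≤ (k : ℝ) / 32 := Nat.cast_div_le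
      have := mul_le_mul_of_nonneg_right this hr
      linarith
    obtain ⟨-, hxi, hxj⟩ := hHmem x hx
    have b1 := (piExp_notMem_unseen_le hR (marginal_fst hp hc1)
      ((Nat.div_le_self k 32).trans hkn) x.1 (ha_le _)).trans
      (small _ k (ha0 _) (by have := hA1 x.1; rw [hxi] at this; rw [hk]; exact_mod_cast this))
    have b2 := (piExp_notMem_unseen_le hR (marginal_snd hp ha1)
      ((Nat.div_le_self l 32).trans hln) x.2 (hc_le _)).trans
      (small _ l (hc0 _) (by have := hC1 x.2; rw [hxj] at this; rw [hl]; exact_mod_cast this))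
    linarith
  have hEV := piExp_sum_sq_unseenRect_le hp0 ha0 hc0 hp ha1 hc1 hk0 hl0 hkn hln
  have hinner : ∀ s₁ s₂, (piExp R (2 ^ I) fun t => piExp R (2 ^ I) fun s =>
        if acceptRule I s₁ s₂ t s = true then (1:ℝ) else 0) ≤
      1 / 10 + (2 / G0 * loss s₁ s₂ + 1 / (100 * rectBound A C k l) *
        ∑ x ∈ unseenRect k l s₁ s₂, (qa x.1 * qc x.2) ^ 2) := by
    intro s₁ s₂
    set W := unseenRect k l s₁ s₂ with hW
    set V := ∑ x ∈ W, (qa x.1 * qc x.2) ^ 2 with hV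
    have hV0 : 0 ≤ V := Finset.sum_nonneg fun _ _ => sq_nonneg _
    have htriv : (piExp R (2 ^ I) fun t => piExp R (2 ^ I) fun s =>
        if acceptRule I s₁ s₂ t s = true then (1:ℝ) else 0) ≤ 1 := by
      have e : (piExp R (2 ^ I) fun _ => piExp R (2 ^ I) fun _ => (1:ℝ)) = 1 := by
        simp only [piExp_const hR]
      conv_rhs => rw [← e]
      exact piExp_mono hR0 fun t => piExp_mono hR0 fun s => by split_ifs <;> norm_num
    have t1 : 0 ≤ 2 / G0 * loss s₁ s₂ := mul_nonneg (by positivity) (hloss0 _ _)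
    have t2 : 0 ≤ 1 / (100 * rectBound A C k l) * V := by positivity
    by_cases c1 : G0 / 2 < loss s₁ s₂
    · have : 1 ≤ 2 / G0 * loss s₁ s₂ := by
        rw [div_mul_eq_mul_div, one_le_div hG0pos]; linarith
      linarith
    by_cases c2 : 100 * rectBound A C k l < V
    · have : 1 ≤ 1 / (100 * rectBound A C k l) * V := by
        rw [one_div_mul_eq_div, one_le_div (by positivity)]; exact c2.le
      linarith
    push Not at c1 c2
    have hrem : G0 / 2 ≤ ∑ x ∈ H.filter (· ∈ W), g x := by
      have : G0 ≤ ∑ x ∈ H.filter (· ∈ W), g x + loss s₁ s₂ := by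
        simp only [loss]
        rw [hG0, Finset.sum_filter (· ∈ W), ← Finset.sum_add_distrib]
        refine Finset.sum_le_sum fun x _ => ?_
        have := hg0 x
        simp only [hW, unseenRect, Finset.mem_product]
        split_ifs <;> first | linarith | (exfalso; tauto)
      linarith
    have hsep := separation hp0 ha0 hc0 ha1 hc1 hk0 hl0 hkn hln hCA Fintype.card_pos hCn hε
      (L := (I:ℝ) + 1) (by linarith [Nat.cast_nonneg (α := ℝ) I]) (by push_cast; exact hN)
      (H.filter (· ∈ W))
      (fun x hx => by
        have := (hHmem x (Finset.mem_filter.1 hx).1).1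
        rwa [Fintype.card_prod, Nat.cast_mul] at this)
      (fun h x hx => by
        have hlt : (i : ℕ) < I := (Nat.pow_lt_pow_iff_right (by norm_num)).1 h
        have hxi := (hHmem x (Finset.mem_filter.1 hx).1).2.1
        have := hA2 x.1
        rw [hxi] at this
        rw [hk]; push_cast; exact this hlt)
      (fun h x hx => by
        have hlt : (j : ℕ) < I := (Nat.pow_lt_pow_iff_right (by norm_num)).1 h
        have hxj := (hHmem x (Finset.mem_filter.1 hx).1).2.2
        have := hC2 x.2
        rw [hxj] at this
        rw [hl]; push_cast; exact this hlt)
      (by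
        refine le_trans ?_ hrem
        have : ε / (2 * ((I:ℝ) + 1) ^ 2) = ε / ((I:ℝ) + 1) ^ 2 / 2 := by
          rw [div_div, mul_comm 2]
        rw [this]
        linarith)
    obtain ⟨hs1, hs2⟩ := hsep
    have hmono : ∑ x ∈ H.filter (· ∈ W), (p x - qa x.1 * qc x.2) ^ 2 ≤
        ∑ x ∈ W, (p x - qa x.1 * qc x.2) ^ 2 :=
      Finset.sum_le_sum_of_subset_of_nonneg (fun x hx => (Finset.mem_filter.1 hx).2)
        fun _ _ _ => sq_nonneg _
    have hmono' := mul_le_mul_of_nonneg_left hmono (sq_nonneg (((2 ^ I : ℕ) : ℝ)))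
    have hI : (0:ℝ) ≤ I := Nat.cast_nonneg I
    change 40000 * ((I:ℝ) + 1) * (((2 ^ I : ℕ) : ℝ) * √(rectBound A C k l)) ≤ _ at hs2
    have hnU : 0 ≤ ((2 ^ I : ℕ) : ℝ) * √(rectBound A C k l) := by positivity
    have hfin := piExp_lt_threshold_le hp0 hq0 hp hq W (2 ^ I) (τ := threshold A C I k l)
      (hs1.trans hmono') (by
        refine le_trans ?_ (hs2.trans hmono')
        have hVle : √V ≤ 10 * √(rectBound A C k l) := by
          rw [show (10:ℝ) = √(10 ^ 2) by rw [Real.sqrt_sq (by norm_num)],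
            ← Real.sqrt_mul (by positivity)]
          exact Real.sqrt_le_sqrt (by linarith)
        have := mul_le_mul_of_nonneg_left hVle (Nat.cast_nonneg (α := ℝ) (2 ^ I))
        nlinarith) (by
        refine le_trans ?_ (hs2.trans hmono')
        unfold threshold
        push_cast at hnU ⊢
        nlinarith)
    have hle : (piExp R (2 ^ I) fun t => piExp R (2 ^ I) fun s =>
        if acceptRule I s₁ s₂ t s = true then (1:ℝ) else 0) ≤
        piExp R (2 ^ I) fun t => piExp R (2 ^ I) fun s =>
          if threshold A C I k l ≤ blockStat W s t then (0:ℝ) else 1 := by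
      refine piExp_mono hR0 fun t => piExp_mono hR0 fun s => ?_
      by_cases h : acceptRule I s₁ s₂ t s = true
      · have h' := h
        simp only [acceptRule, decide_eq_true_eq] at h'
        rw [if_pos h, if_neg (not_le.2 (h' i j))]
      · rw [if_neg h]; split_ifs <;> norm_num
    have := hle.trans hfin
    linarith
  refine (piExp_mono hR0 fun s₁ => piExp_mono hR0 fun s₂ => hinner s₁ s₂).trans ?_
  simp only [piExp_add, piExp_const hR, piExp_const_mul]
  have f1 := mul_le_mul_of_nonneg_left hEloss (by positivity : 0 ≤ 2 / G0)
  have f2 := mul_le_mul_of_nonneg_left hEV (by positivity : 0 ≤ 1 / (100 * rectBound A C k l))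
  have e1 : 2 / G0 * (G0 / 16) = 1 / 8 := by field_simp; norm_num
  have e2 : 1 / (100 * rectBound A C k l) * rectBound A C k l = 1 / 100 := by field_simp
  rw [e1] at f1
  rw [e2] at f2
  linarith

end Rule

section SampleSize

variable {a c ε : ℝ}

theorem le_rpow_mul_rpow (hc : 1 ≤ c) (hca : c ≤ a) {s t : ℝ} (hs : 0 ≤ s)
    (hst : s + t = 1) : c ≤ a ^ s * c ^ t := by
  calc c = c ^ s * c ^ t := by rw [← Real.rpow_add (by linarith), hst, Real.rpow_one]
    _ ≤ a ^ s * c ^ t := by gcongr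

theorem rpow_mul_rpow_le (ha : 1 ≤ a) (hc : 1 ≤ c) {s t : ℝ} (hs : s ≤ 1) (ht : t ≤ 1) :
    a ^ s * c ^ t ≤ a * c := by
  have h1 := Real.rpow_le_rpow_of_exponent_le ha hs
  have h2 := Real.rpow_le_rpow_of_exponent_le hc ht
  rw [Real.rpow_one] at h1 h2
  exact mul_le_mul h1 h2 (Real.rpow_nonneg (by linarith) _) (by linarith)

theorem sq_first_rate (ha : 0 ≤ a) (hc : 0 ≤ c) :
    (a ^ (3 / 4 : ℝ) * c ^ (1 / 4 : ℝ)) ^ 2 = a * √c * √a := by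
  rw [mul_pow, ← Real.rpow_natCast, ← Real.rpow_natCast, ← Real.rpow_mul ha, ← Real.rpow_mul hc,
    Real.sqrt_eq_rpow, Real.sqrt_eq_rpow, mul_right_comm]
  congr 1
  · rcases ha.eq_or_lt with rfl | ha
    · norm_num
    · nth_rewrite 2 [← Real.rpow_one a]
      rw [← Real.rpow_add ha]; norm_num
  · norm_num

theorem rpow_second_rate (ha : 0 ≤ a) (hc : 0 ≤ c) (hε : 0 ≤ ε) :
    (a ^ (2 / 3 : ℝ) * c ^ (1 / 3 : ℝ) / ε ^ (4 / 3 : ℝ)) ^ (3 / 2 : ℝ) = a * √c / ε ^ 2 := by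
  rw [Real.div_rpow (by positivity) (by positivity), Real.mul_rpow (by positivity) (by positivity),
    ← Real.rpow_mul ha, ← Real.rpow_mul hc, ← Real.rpow_mul hε, Real.sqrt_eq_rpow,
    ← Real.rpow_natCast ε]
  norm_num

/-- The condition on the block size `n` holds once `n` exceeds either of the two rates. -/
theorem block_size_condition {n B F : ℝ} (hn : 0 < n) (ha : 0 < a) (hc : 0 < c) (hε : 0 < ε)
    (hB : 1 ≤ B) (hF : F ≤ B ^ (3 / 2 : ℝ))
    (h : B * min (a ^ (3 / 4 : ℝ) * c ^ (1 / 4 : ℝ) / ε)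
      (a ^ (2 / 3 : ℝ) * c ^ (1 / 3 : ℝ) / ε ^ (4 / 3 : ℝ)) ≤ n) :
    F * (a * √c * √(min n a)) ≤ (n * ε) ^ 2 := by
  have hB0 : 0 < B := by linarith
  refine (mul_le_mul_of_nonneg_right hF (by positivity)).trans ?_
  rcases min_choice (a ^ (3 / 4 : ℝ) * c ^ (1 / 4 : ℝ) / ε)
      (a ^ (2 / 3 : ℝ) * c ^ (1 / 3 : ℝ) / ε ^ (4 / 3 : ℝ)) with h1 | h1 <;> rw [h1] at h
  · rw [mul_div_assoc', div_le_iff₀ hε] at h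
    calc B ^ (3 / 2 : ℝ) * (a * √c * √(min n a)) ≤ B ^ 2 * (a * √c * √a) := by
          gcongr
          · rw [← Real.rpow_natCast]
            exact Real.rpow_le_rpow_of_exponent_le hB (by norm_num)
          · exact min_le_right _ _
      _ = (B * (a ^ (3 / 4 : ℝ) * c ^ (1 / 4 : ℝ))) ^ 2 := by
          rw [mul_pow, sq_first_rate ha.le hc.le]
      _ ≤ (n * ε) ^ 2 := by gcongr
  · have h2 := Real.rpow_le_rpow (by positivity) h (by norm_num : (0:ℝ) ≤ 3 / 2)
    rw [Real.mul_rpow hB0.le (by positivity), rpow_second_rate ha.le hc.le hε.le,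
      mul_div_assoc', div_le_iff₀ (by positivity)] at h2
    calc B ^ (3 / 2 : ℝ) * (a * √c * √(min n a)) ≤ B ^ (3 / 2 : ℝ) * (a * √c * √n) := by
          gcongr
          exact min_le_left _ _
      _ = B ^ (3 / 2 : ℝ) * (a * √c) * √n := by ring
      _ ≤ n ^ (3 / 2 : ℝ) * ε ^ 2 * √n := by gcongr
      _ = n ^ (3 / 2 : ℝ) * √n * ε ^ 2 := by ring
      _ = (n * ε) ^ 2 := by
          rw [Real.sqrt_eq_rpow, ← Real.rpow_add hn, mul_pow, ← Real.rpow_natCast n]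
          norm_num

theorem exists_block_exponent (hc : 1 ≤ c) (hca : c ≤ a) (hε : 0 < ε) (hε1 : ε ≤ 1) :
    ∃ I : ℕ, c ≤ 2 ^ I ∧
      2 ^ 61 * ((I:ℝ) + 1) ^ 6 * (a * √c * √(min ((2:ℝ) ^ I) a)) ≤ (2 ^ I * ε) ^ 2 ∧
      4 * (2:ℝ) ^ I ≤ 2 ^ 83 * Real.log (2 + a * c / ε) ^ 4 *
        min (a ^ (3 / 4 : ℝ) * c ^ (1 / 4 : ℝ) / ε)
          (a ^ (2 / 3 : ℝ) * c ^ (1 / 3 : ℝ) / ε ^ (4 / 3 : ℝ)) := by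
  have ha : 1 ≤ a := hc.trans hca
  have ha0 : 0 < a := by linarith
  have hc0 : 0 < c := by linarith
  have hac : 1 ≤ a * c / ε := by
    rw [one_le_div hε]
    exact hε1.trans (one_le_mul_of_one_le_of_one_le ha hc)
  set Λ := Real.log (2 + a * c / ε) with hΛ
  have hΛ1 : 1 ≤ Λ := by
    rw [hΛ, Real.le_log_iff_exp_le (by positivity)]
    linarith [Real.exp_one_lt_d9]
  set X := min (a ^ (3 / 4 : ℝ) * c ^ (1 / 4 : ℝ) / ε)
    (a ^ (2 / 3 : ℝ) * c ^ (1 / 3 : ℝ) / ε ^ (4 / 3 : ℝ)) with hX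
  have hXc : c ≤ X := by
    refine le_min ?_ ?_
    · rw [le_div_iff₀ hε]
      have := le_rpow_mul_rpow hc hca (s := 3 / 4) (t := 1 / 4) (by norm_num) (by norm_num)
      nlinarith
    · have h1 : ε ^ (4 / 3 : ℝ) ≤ 1 := Real.rpow_le_one hε.le hε1 (by norm_num)
      have h0 : 0 < ε ^ (4 / 3 : ℝ) := by positivity
      rw [le_div_iff₀ h0]
      have := le_rpow_mul_rpow hc hca (s := 2 / 3) (t := 1 / 3) (by norm_num) (by norm_num)
      nlinarith
  have hXac : X ≤ a * c / ε := by
    refine (min_le_left _ _).trans ?_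
    exact div_le_div_of_nonneg_right (rpow_mul_rpow_le ha hc (by norm_num) (by norm_num)) hε.le
  have hX1 : 1 ≤ X := hc.trans hXc
  have hΛ4 : 1 ≤ Λ ^ 4 := one_le_pow₀ hΛ1
  set B := 2 ^ 80 * Λ ^ 4 with hB
  have hB1 : 1 ≤ B := by rw [hB]; linarith
  obtain ⟨i, hi1, hi2⟩ := exists_nat_pow_near (one_le_mul_of_one_le_of_one_le hB1 hX1)
    (by norm_num : (1:ℝ) < 2)
  have hup : (2:ℝ) ^ (i + 1) ≤ 2 * (B * X) := by rw [pow_succ]; linarith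
  have hL : (((i + 1 : ℕ) : ℝ) + 1) ≤ 92 * Λ := by
    have h1 : (2:ℝ) ^ (i + 1) ≤ 2 ^ 81 * (Λ ^ 4 * (a * c / ε)) := by
      refine hup.trans ?_
      rw [hB]
      have := mul_le_mul_of_nonneg_left hXac (by positivity : 0 ≤ Λ ^ 4)
      linarith
    have h2 := Real.log_le_log (by positivity) h1
    rw [Real.log_pow, Real.log_mul (by positivity) (by positivity), Real.log_mul (by positivity)
      (by positivity), Real.log_pow, Real.log_pow] at h2
    have h3 : Real.log Λ ≤ Λ := (Real.log_le_sub_one_of_pos (by linarith)).trans (by linarith)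
    have h4 : Real.log (a * c / ε) ≤ Λ := Real.log_le_log (by positivity) (by linarith)
    have h5 : 1 / 2 < Real.log 2 := by linarith [Real.log_two_gt_d9]
    push_cast at h2 ⊢
    by_contra hcon
    push Not at hcon
    have h6 : 0 < ((i:ℝ) + 1 - 81) := by linarith
    nlinarith
  refine ⟨i + 1, ?_, ?_, ?_⟩
  · exact hXc.trans ((le_mul_of_one_le_left (by linarith) hB1).trans hi2.le)
  · refine block_size_condition (by positivity) ha0 hc0 hε hB1 ?_ hi2.le
    have e : B ^ (3 / 2 : ℝ) = 2 ^ 120 * Λ ^ 6 := by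
      rw [hB, Real.mul_rpow (by positivity) (by positivity), ← Real.rpow_natCast,
        ← Real.rpow_natCast, ← Real.rpow_mul (by norm_num), ← Real.rpow_mul (by linarith),
        ← Real.rpow_natCast, ← Real.rpow_natCast]
      norm_num
    rw [e]
    calc 2 ^ 61 * (((i + 1 : ℕ) : ℝ) + 1) ^ 6 ≤ 2 ^ 61 * (92 * Λ) ^ 6 := by gcongr
      _ = 2 ^ 61 * 92 ^ 6 * Λ ^ 6 := by ring
      _ ≤ 2 ^ 120 * Λ ^ 6 := by
          gcongr
          norm_num
  · rw [hB] at hup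
    linarith

end SampleSize

section Testers

theorem hellingerSq_le_one {Ω : Type} [Fintype Ω] (P Q : PMF Ω) : hellingerSq P Q ≤ 1 := by
  unfold hellingerSq
  have h : ∑ x, (√(P x).toReal - √(Q x).toReal) ^ 2 ≤ ∑ x, ((P x).toReal + (Q x).toReal) := by
    refine Finset.sum_le_sum fun x _ => ?_
    have h1 := Real.sq_sqrt (ENNReal.toReal_nonneg (a := P x))
    have h2 := Real.sq_sqrt (ENNReal.toReal_nonneg (a := Q x))
    have h3 := mul_nonneg (Real.sqrt_nonneg (P x).toReal) (Real.sqrt_nonneg (Q x).toReal)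
    nlinarith
  rw [Finset.sum_add_distrib, sum_toReal_pmf, sum_toReal_pmf] at h
  linarith

variable {A C : Type} [Fintype A] [Fintype C] [MeasurableSpace A] [MeasurableSpace C]

/-- No samples are needed beyond the diameter of the Hellinger distance. -/
theorem exists_succeeds_of_one_lt {ε : ℝ} (hε : 1 < ε) :
    ∃ T : Tester (A × C) 0, Succeeds hellingerSq ε T := by
  refine ⟨fun _ _ => PMF.pure true, fun P Q _ => ⟨fun _ => ?_, fun h => ?_⟩⟩
  · have : IsProbabilityMeasure (iidLaw P 0) := by unfold iidLaw; infer_instance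
    have : IsProbabilityMeasure (iidLaw Q 0) := by unfold iidLaw; infer_instance
    simp only [outputProb, PMF.pure_apply, if_true, lintegral_const, measure_univ, mul_one]
    exact ENNReal.div_le_of_le_mul (by norm_num)
  · linarith [hellingerSq_le_one P Q]

variable [MeasurableSingletonClass A] [MeasurableSingletonClass C] [Nonempty A] [Nonempty C]

theorem exists_succeeds {I : ℕ} {ε : ℝ} (hε : 0 < ε)
    (hCA : Fintype.card C ≤ Fintype.card A) (hCn : Fintype.card C ≤ 2 ^ I)
    (hN : 2 ^ 61 * ((I:ℝ) + 1) ^ 6 * (Fintype.card A * √(Fintype.card C) *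
      √(min ((2:ℝ) ^ I) (Fintype.card A))) ≤ (2 ^ I * ε) ^ 2) :
    ∃ T : Tester (A × C) (2 ^ I + (2 ^ I + (2 ^ I + 2 ^ I))), Succeeds hellingerSq ε T := by
  classical
  refine exists_succeeds_of_fourBlocks _ _ (acceptRule I) fun P Q hQ b h1 h2 => ?_
  obtain ⟨QA, QC, hprod⟩ := hQ
  have hQeq : (fun x => (Q x).toReal) = fun x : A × C => (QA x.1).toReal * (QC x.2).toReal := by
    funext x
    rw [show x = (x.1, x.2) from rfl, hprod, ENNReal.toReal_mul]
  have hA0 : ∀ a, 0 ≤ (QA a).toReal := fun _ => ENNReal.toReal_nonneg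
  have hC0 : ∀ c, 0 ≤ (QC c).toReal := fun _ => ENNReal.toReal_nonneg
  cases b with
  | false =>
    obtain rfl := h1 rfl
    simp only [hQeq]
    exact completeness hA0 hC0 (sum_toReal_pmf QA) (sum_toReal_pmf QC) I
  | true =>
    have hfar := h2 rfl
    unfold hellingerSq at hfar
    simp only [fun x => congrFun hQeq x] at hfar
    simp only [hQeq]
    exact soundness (fun _ => ENNReal.toReal_nonneg) hA0 hC0 (sum_toReal_pmf P)
      (sum_toReal_pmf QA) (sum_toReal_pmf QC) I hCA hCn hε hN hfar

end Testers

theorem sampleComplexity_le {A C : Type} [MeasurableSpace A] [MeasurableSpace C]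
    {Δ : PMF (A × C) → PMF (A × C) → ℝ} {ε : ℝ} {N : ℕ}
    (h : ∃ T : Tester (A × C) N, Succeeds Δ ε T) {x : ℝ} (hx : (N : ℝ) ≤ x) :
    ((sampleComplexity Δ ε : ℕ∞) : ℝ≥0∞) ≤ ENNReal.ofReal x := by
  have h1 : sampleComplexity Δ ε ≤ (N : ℕ∞) := iInf₂_le N h
  calc ((sampleComplexity Δ ε : ℕ∞) : ℝ≥0∞) ≤ ((N : ℕ∞) : ℝ≥0∞) := ENat.toENNReal_le.2 h1
    _ = ENNReal.ofReal N := by simp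
    _ ≤ ENNReal.ofReal x := ENNReal.ofReal_le_ofReal hx

end EqProd

end

theorem mainTheorem5 :
    ∃ (K : ℝ) (k : ℕ), 0 < K ∧
      ∀ (dA dC : ℕ) (ε : ℝ), 1 ≤ dC → dC ≤ dA → 0 < ε →
        ((EqProd.sampleComplexity (A := Fin dA) (C := Fin dC) EqProd.hellingerSq ε : ℕ∞) : ℝ≥0∞) ≤
          ENNReal.ofReal
            (K * Real.log (2 + (dA : ℝ) * (dC : ℝ) / ε) ^ k *
              min ((dA : ℝ) ^ (3 / 4 : ℝ) * (dC : ℝ) ^ (1 / 4 : ℝ) / ε)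
                ((dA : ℝ) ^ (2 / 3 : ℝ) * (dC : ℝ) ^ (1 / 3 : ℝ) / ε ^ (4 / 3 : ℝ))) := by
  refine ⟨2 ^ 83, 4, by positivity, fun dA dC ε hC hCA hε => ?_⟩
  rcases lt_or_ge 1 ε with h1 | h1
  · exact EqProd.sampleComplexity_le (EqProd.exists_succeeds_of_one_lt h1)
      (by rw [Nat.cast_zero]; positivity)
  · obtain ⟨I, hI1, hI2, hI3⟩ := EqProd.exists_block_exponent (a := dA) (c := dC)
      (by exact_mod_cast hC) (by exact_mod_cast hCA) hε h1
    have : Nonempty (Fin dC) := ⟨⟨0, hC⟩⟩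
    have : Nonempty (Fin dA) := ⟨⟨0, hC.trans hCA⟩⟩
    refine EqProd.sampleComplexity_le (EqProd.exists_succeeds (I := I) hε ?_ ?_ ?_) ?_
    · simpa using hCA
    · rw [Fintype.card_fin]; exact_mod_cast hI1
    · simpa only [Fintype.card_fin] using hI2
    · push_cast
      linarith
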